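/- **Language.** Fix propositional letters, an infinite set of nominals, state variables and a finite set $\mathsf{REL}$ of relation symbols. A relation $R$ is $r$ or $r^-$ with $r\in\mathsf{REL}$; $\mathsf{Inv}(r)=r^-$, $\mathsf{Inv}(r^-)=r$. Formulae are built from propositional letters $p$, nominals $a$ and variables $x$ by $\neg,\wedge,\vee,\Diamond_R,\Box_R,\mathsf E,\mathsf A$, $t\mathord{:}F$ ($t$ a nominal or variable) and ${\downarrow}x.F$. Assertions are $\mathsf{Trans}(r)$ and $R\sqsubseteq s$ with $s\in\mathsf{REL}$; $R\sqsubseteq s^-$ stands for $\mathsf{Inv}(R)\sqsubseteq s$ and $\mathsf{Trans}(r^-)$ for $\mathsf{Trans}(r)$. A relational formula is $a\Rightarrow_R b$, which denotes $a\mathord{:}\Diamond_r b$ if $R=r$ and $b\mathord{:}\Diamond_r a$ if $R=r^-$. **Calculus.** Let $F$ be a closed formula in negation normal form in which no universal operator ($\Box_R$, $\mathsf A$) occurs in the scope of a binder, and $\mathcal A$ a set of assertions. Nodes of a branch are labelled by assertions or by statements $a\mathord{:}G$. The initial branch consists of root nodes: $a_0\mathord{:}F$ ($a_0$ a new nominal)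 and the closure of $\mathcal A$ under adding $r\sqsubseteq r$ for all $r\in\mathsf{REL}$ and $R\sqsubseteq P$ whenever $R\sqsubseteq S$, $S\sqsubseteq P$ are present. Branches are extended by: - $(\wedge)$ $a\mathord{:}G\wedge H\,/\,a\mathord{:}G,\ a\mathord{:}H$; $(\vee)$ $a\mathord{:}G\vee H\,/\,a\mathord{:}G\mid a\mathord{:}H$; $(:)$ $a\mathord{:}b\mathord{:}G\,/\,b\mathord{:}G$; $(\downarrow)$ $a\mathord{:}{\downarrow}x.G\,/\,a\mathord{:}G[a/x]$; - $(\Box)$ $a\mathord{:}\Box_RG,\ a\Rightarrow_Rb\,/\,b\mathord{:}G$; $(\mathsf A)$ $a\mathord{:}\mathsf AG\,/\,c\mathord{:}G$, the minor premise being any node in which $c$ occurs; - $(\mathsf{Link})$ $a\Rightarrow_Rb,\ R\sqsubseteq S\,/\,a\Rightarrow_Sb$; $(\mathsf{Trans})$ $a\mathord{:}\Box_SG,\ a\Rightarrow_Rb,\ \mathsf{Trans}(R),\ R\sqsubseteq S\,/\,b\mathord{:}\Box_RG$; - the blockable rules $(\Diamond)$ $a\mathord{:}\Diamond_RG\,/\,a\Rightarrow_Rb,\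 b\mathord{:}G$ (premise not a relational formula) and $(\mathsf E)$ $a\mathord{:}\mathsf EG\,/\,b\mathord{:}G$, with $b$ a new nominal; the nodes carrying such premises are called blockable; - $(=)$ given $a\mathord{:}b$ with $a\neq b$, replace $a$ by $b$ in the whole branch. Nodes produced by a blockable rule are children of the expanded node in the offspring relation; a node produced by any other rule is a sibling of its premise ($a\Rightarrow_Rb$ for $\Box$, $\mathsf{Link}$, $\mathsf{Trans}$; the minor premise for $\mathsf A$). Nominals $a,b$ are compatible in a set of nodes if for all $p,R,G$: $a\mathord{:}p$ occurs iff $b\mathord{:}p$ does, and $a\mathord{:}\Box_RG$ occurs iff $b\mathord{:}\Box_RG$ does. A mapping for a branch is an injective function from its nominals to themselves that is the identity on the top nominals (those occurring in the label of the first node) and sends every nominal to a compatible one. A node is a phantom if some proper ancestor is directly blocked. A non-phantom blockable node $n$ is directly blocked by $m$ by means of $\pi$ if $m$ is an earlier blockable node which is neither phantom nor directly blocked, and $\pi$ is a mapping with $\pi(\mathrm{label}(m))=\mathrm{label}(n)$. Restrictions: a formula already labelling a non-phantom node is not added again; a blockable rule is applied at most once to a node, and never to a phantom or directly blocked one; phantom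 nodes are used only as premises of the form $a\mathord{:}\Box_RG$. A branch is complete if no rule applies to it, and open if it contains no $a\mathord{:}\neg a$ and no pair $a\mathord{:}p$, $a\mathord{:}\neg p$. **Extensions.** Let $\mathcal B$ be a complete open branch of a tableau for $\{F\}\cup\mathcal A$. The set $\mathcal N_0$ consists of the non-phantom nodes of $\mathcal B$ and of the nodes of $\mathcal B$ labelled by some $a\mathord{:}p$ or $a\mathord{:}\Box_RG$ with $a$ occurring in a non-phantom node. A witness in $\mathcal N$ of a node labelled by $a\mathord{:}\Diamond_RG$ (resp. $a\mathord{:}\mathsf EG$) is given by a nominal $d$ with $a\Rightarrow_Rd,\ d\mathord{:}G\in\mathcal N$ (resp. $d\mathord{:}G\in\mathcal N$), where $G\in\mathcal N$ means that $G$ labels a node of $\mathcal N$. The relation $\mathbf B_0$ is the set of triples $(n,m,\pi)$ with $n\in\mathcal N_0$ having no witness in $\mathcal N_0$ and directly blocked by $m$ by means of $\pi$. Given $\mathcal N_i,\mathbf B_i$, choose $(n,m,\pi)\in\mathbf B_i$; let $b$ be the nominal introduced by the expansion of $m$ in $\mathcal B$ and let $\theta_i$ be $\pi$ modified by $b\mapsto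 b_i$ with $b_i$ a new nominal (if $b$ has been identified with a nominal which already occurred in the branch when $m$ was expanded, $\theta_i=\pi$). For every $k\in\mathcal N_0$ such that $\theta_i(\mathrm{label}(k))$ labels no node of $\mathcal N_i$, add a node $k^{i+1}$ with this label; the result is $\mathcal N_{i+1}$. The relation $\mathbf B_{i+1}$ consists of the triples of $\mathbf B_i$ and the triples $(k^{i+1},m',\theta_i\circ\pi')$, for new nodes $k^{i+1}$ with $(k,m',\pi')\in\mathbf B_0$, whose first component has no witness in $\mathcal N_{i+1}$. **Lemma.** For every complete open branch $\mathcal B$, every sequence of extensions as above and every $i$, $\mathcal N_i$ is pseudo-saturated with respect to $\mathbf B_i$, i.e., for all nominals, formulae and relations: 1. no node of $\mathcal N_i$ is labelled by some $a\mathord{:}\neg a$; 2. there are no nodes labelled by $a\mathord{:}p$ and $a\mathord{:}\neg p$; 3. if $a\mathord{:}d\in\mathcal N_i$ with $d$ a nominal, then $a=d$; 4. if $a\mathord{:}G\wedge H\in\mathcal N_i$, then $a\mathord{:}G,\ a\mathord{:}H\in\mathcal N_i$; 5. if $a\mathord{:}G\vee H\in\mathcal N_i$, then $a\mathord{:}G\in\mathcal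 N_i$ or $a\mathord{:}H\in\mathcal N_i$; 6. if $a\mathord{:}d\mathord{:}G\in\mathcal N_i$, then $d\mathord{:}G\in\mathcal N_i$; 7. if $a\mathord{:}{\downarrow}x.G\in\mathcal N_i$, then $a\mathord{:}G[a/x]\in\mathcal N_i$; 8. if $n\in\mathcal N_i$ is labelled by $a\mathord{:}\Diamond_RG$, not a relational formula, and $\mathbf B_i$ contains no triple $(n,n',\pi)$, then $a\Rightarrow_Rd,\ d\mathord{:}G\in\mathcal N_i$ for some $d$; 9. if $a\mathord{:}\Box_RG,\ a\Rightarrow_Rd\in\mathcal N_i$, then $d\mathord{:}G\in\mathcal N_i$; 10. if $n\in\mathcal N_i$ is labelled by $a\mathord{:}\mathsf EG$ and $\mathbf B_i$ contains no triple $(n,n',\pi)$, then $d\mathord{:}G\in\mathcal N_i$ for some $d$; 11. if $a\mathord{:}\mathsf AG\in\mathcal N_i$ and $d$ occurs in $\mathcal N_i$, then $d\mathord{:}G\in\mathcal N_i$; 12. $r\sqsubseteq r\in\mathcal N_i$ for all $r\in\mathsf{REL}$; 13. if $R\sqsubseteq S,\ S\sqsubseteq P\in\mathcal N_i$, then $R\sqsubseteq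 P\in\mathcal N_i$; 14. if $a\Rightarrow_Rb,\ R\sqsubseteq S\in\mathcal N_i$, then $a\Rightarrow_Sb\in\mathcal N_i$; 15. if $a\mathord{:}\Box_SG,\ a\Rightarrow_Rb,\ \mathsf{Trans}(R),\ R\sqsubseteq S\in\mathcal N_i$, then $b\mathord{:}\Box_RG\in\mathcal N_i$. -/

import Mathlib

namespace HybridTableau

universe u₁ u₂ u₃ u₄

/-! ### Syntax

`P`, `N`, `V`, `S` are the types of propositional letters, nominals, state variables and relation
symbols. -/

/-- Relations: a forward relation `r` or a backward relation `r⁻`. -/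
inductive Relation (S : Type u₄) : Type u₄
  | fwd (r : S)
  | bwd (r : S)

namespace Relation

variable {S : Type u₄}

/-- `Inv(R)`. -/
def inv : Relation S → Relation S
  | fwd r => bwd r
  | bwd r => fwd r

/-- The relation symbol underlying a relation. -/
def sym : Relation S → S
  | fwd r => r
  | bwd r => r

end Relation

/-- Terms in nominal position: nominals and state variables. -/
inductive Term (N : Type u₂) (V : Type u₃) : Type (max u₂ u₃)
  | nom (a : N)
  | var (x : V)

/-- Formulae of multi-modal hybrid logic with binder, converse and global modalities. -/
inductive Formula (P : Type u₁) (N : Type u₂) (V : Type u₃) (S : Type u₄) :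
    Type (max u₁ u₂ u₃ u₄)
  | prop (p : P)
  | term (t : Term N V)
  | neg (F : Formula P N V S)
  | and (F G : Formula P N V S)
  | or (F G : Formula P N V S)
  | dia (R : Relation S) (F : Formula P N V S)
  | box (R : Relation S) (F : Formula P N V S)
  | ex (F : Formula P N V S)
  | all (F : Formula P N V S)
  | at (t : Term N V) (F : Formula P N V S)
  | down (x : V) (F : Formula P N V S)

/-- Assertions: transitivity `Trans(r)` and inclusion `R ⊑ s`, with `s` a relation symbol. -/
inductive Assertion (S : Type u₄) : Type u₄
  | trans (r : S)
  | incl (R : Relation S) (s : S)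

namespace Assertion

variable {S : Type u₄}

/-- `R ⊑ T` for arbitrary relations; `R ⊑ s⁻` is another notation for `Inv(R) ⊑ s`. -/
def sub (R : Relation S) : Relation S → Assertion S
  | .fwd s => incl R s
  | .bwd s => incl R.inv s

/-- `Trans(R)` for arbitrary relations; `Trans(r⁻)` is another notation for `Trans(r)`. -/
def transR (R : Relation S) : Assertion S := trans R.sym

/-- The relation symbols of an assertion. -/
def syms : Assertion S → Set S
  | trans r => {r}
  | incl R s => {R.sym, s}

/-- The assertions obtained from `A` by applying as far as possible the assertion rules:
`r ⊑ r` for every `r ∈ REL`, and `R ⊑ T, T ⊑ U / R ⊑ U`. -/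
inductive Closure (REL : Finset S) (A : Set (Assertion S)) : Assertion S → Prop
  | mem {α : Assertion S} : α ∈ A → Closure REL A α
  | refl {r : S} : r ∈ REL → Closure REL A (sub (.fwd r) (.fwd r))
  | trans {R T U : Relation S} :
      Closure REL A (sub R T) → Closure REL A (sub T U) → Closure REL A (sub R U)

end Assertion

namespace Term

variable {N : Type u₂} {V : Type u₃}

/-- Nominals occurring in a term. -/
def noms : Term N V → Set N
  | nom a => {a}
  | var _ => ∅

/-- Variables occurring in a term. -/
def vars : Term N V → Set V
  | nom _ => ∅
  | var x => {x}

/-- Apply a function to the nominals of a term. -/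
def rename (f : N → N) : Term N V → Term N V
  | nom a => nom (f a)
  | var x => var x

open Classical in
/-- `t[a/x]`. -/
noncomputable def inst (a : N) (x : V) : Term N V → Term N V
  | nom b => nom b
  | var y => if y = x then nom a else var y

end Term

namespace Formula

variable {P : Type u₁} {N : Type u₂} {V : Type u₃} {S : Type u₄}

/-- Nominals occurring in a formula. -/
def noms : Formula P N V S → Set N
  | prop _ => ∅
  | term t => t.noms
  | neg F => F.noms
  | and F G => F.noms ∪ G.noms
  | or F G => F.noms ∪ G.noms
  | dia _ F => F.noms
  | box _ F => F.noms
  | ex F => F.noms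
  | all F => F.noms
  | .at t F => t.noms ∪ F.noms
  | down _ F => F.noms

/-- Free state variables of a formula. -/
def freeVars : Formula P N V S → Set V
  | prop _ => ∅
  | term t => t.vars
  | neg F => F.freeVars
  | and F G => F.freeVars ∪ G.freeVars
  | or F G => F.freeVars ∪ G.freeVars
  | dia _ F => F.freeVars
  | box _ F => F.freeVars
  | ex F => F.freeVars
  | all F => F.freeVars
  | .at t F => t.vars ∪ F.freeVars
  | down x F => F.freeVars \ {x}

/-- Relation symbols of a formula. -/
def syms : Formula P N V S → Set S
  | prop _ => ∅
  | term _ => ∅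
  | neg F => F.syms
  | and F G => F.syms ∪ G.syms
  | or F G => F.syms ∪ G.syms
  | dia R F => {R.sym} ∪ F.syms
  | box R F => {R.sym} ∪ F.syms
  | ex F => F.syms
  | all F => F.syms
  | .at _ F => F.syms
  | down _ F => F.syms

/-- Apply a function to all nominals of a formula. -/
def rename (f : N → N) : Formula P N V S → Formula P N V S
  | prop p => prop p
  | term t => term (t.rename f)
  | neg F => neg (F.rename f)
  | and F G => and (F.rename f) (G.rename f)
  | or F G => or (F.rename f) (G.rename f)
  | dia R F => dia R (F.rename f)
  | box R F => box R (F.rename f)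
  | ex F => ex (F.rename f)
  | all F => all (F.rename f)
  | .at t F => .at (t.rename f) (F.rename f)
  | down x F => down x (F.rename f)

open Classical in
/-- `F[a/x]`: replace the free occurrences of `x` by the nominal `a`. -/
noncomputable def inst (a : N) (x : V) : Formula P N V S → Formula P N V S
  | prop p => prop p
  | term t => term (t.inst a x)
  | neg F => neg (F.inst a x)
  | and F G => and (F.inst a x) (G.inst a x)
  | or F G => or (F.inst a x) (G.inst a x)
  | dia R F => dia R (F.inst a x)
  | box R F => box R (F.inst a x)
  | ex F => ex (F.inst a x)
  | all F => all (F.inst a x)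
  | .at t F => .at (t.inst a x) (F.inst a x)
  | down y F => if y = x then down y F else down y (F.inst a x)

/-- Negation normal form: negation is applied only to propositional letters, nominals and
variables. -/
def IsNNF : Formula P N V S → Prop
  | prop _ => True
  | term _ => True
  | neg (prop _) => True
  | neg (term _) => True
  | neg _ => False
  | and F G => F.IsNNF ∧ G.IsNNF
  | or F G => F.IsNNF ∧ G.IsNNF
  | dia _ F => F.IsNNF
  | box _ F => F.IsNNF
  | ex F => F.IsNNF
  | all F => F.IsNNF
  | .at _ F => F.IsNNF
  | down _ F => F.IsNNF

/-- The formula contains no universal operator (`□` or `A`). -/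
def NoUniversal : Formula P N V S → Prop
  | prop _ => True
  | term _ => True
  | neg F => F.NoUniversal
  | and F G => F.NoUniversal ∧ G.NoUniversal
  | or F G => F.NoUniversal ∧ G.NoUniversal
  | dia _ F => F.NoUniversal
  | box _ _ => False
  | ex F => F.NoUniversal
  | all _ => False
  | .at _ F => F.NoUniversal
  | down _ F => F.NoUniversal

/-- No universal operator occurs in the scope of a binder. -/
def NoUniversalUnderBinder : Formula P N V S → Prop
  | prop _ => True
  | term _ => True
  | neg F => F.NoUniversalUnderBinder
  | and F G => F.NoUniversalUnderBinder ∧ G.NoUniversalUnderBinder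
  | or F G => F.NoUniversalUnderBinder ∧ G.NoUniversalUnderBinder
  | dia _ F => F.NoUniversalUnderBinder
  | box _ F => F.NoUniversalUnderBinder
  | ex F => F.NoUniversalUnderBinder
  | all F => F.NoUniversalUnderBinder
  | .at _ F => F.NoUniversalUnderBinder
  | down _ F => F.NoUniversal

/-- The input formulae of the calculus: closed formulae in negation normal form where no universal
operator occurs in the scope of a binder. -/
def InFragment (F : Formula P N V S) : Prop :=
  F.freeVars = ∅ ∧ F.IsNNF ∧ F.NoUniversalUnderBinder

end Formula

/-- Node labels: satisfaction statements `a : F` and assertions. -/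
inductive Label (P : Type u₁) (N : Type u₂) (V : Type u₃) (S : Type u₄) :
    Type (max u₁ u₂ u₃ u₄)
  | sat (a : N) (F : Formula P N V S)
  | asrt (α : Assertion S)

namespace Label

variable {P : Type u₁} {N : Type u₂} {V : Type u₃} {S : Type u₄}

/-- Nominals occurring in a label. -/
def noms : Label P N V S → Set N
  | sat a F => {a} ∪ F.noms
  | asrt _ => ∅

/-- Apply a function to all nominals of a label. -/
def rename (f : N → N) : Label P N V S → Label P N V S
  | sat a F => sat (f a) (F.rename f)
  | asrt α => asrt α

/-- The relational formula `a ⇒_R b`: it is `a : ◇_r b` if `R = r`, and `b : ◇_r a` if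
`R = r⁻`. -/
def rel (a : N) : Relation S → N → Label P N V S
  | .fwd r, b => sat a (.dia (.fwd r) (.term (.nom b)))
  | .bwd r, b => sat b (.dia (.fwd r) (.term (.nom a)))

/-- Relational formulae. -/
def IsRelational (l : Label P N V S) : Prop := ∃ a R b, l = rel a R b

/-- Labels of blockable nodes: `a : ◇_R F` which is not a relational formula, and `a : E F`. -/
def Blockable (l : Label P N V S) : Prop :=
  (∃ a R F, l = sat a (.dia R F) ∧ ¬ l.IsRelational) ∨ ∃ a F, l = sat a (.ex F)

/-- `BlockableRule l b c`: expanding a node labelled by `l` by means of the blockable rule for `l`,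
with new nominal `b`, produces nodes labelled by the elements of `c`. -/
inductive BlockableRule : Label P N V S → N → List (Label P N V S) → Prop
  | dia {a : N} {R : Relation S} {F : Formula P N V S} {b : N} :
      ¬ (sat a (.dia R F)).IsRelational →
        BlockableRule (sat a (.dia R F)) b [rel a R b, sat b F]
  | ex {a : N} {F : Formula P N V S} {b : N} :
      BlockableRule (sat a (.ex F)) b [sat b F]

end Label

/-! ### Branches -/

/-- A node of a tableau branch. Nodes are named by their position in the branch.
`parent` is the parent w.r.t. the offspring relation (`none` for root nodes).
For an expanded blockable node, `expanded = some (b, D)`, where `b` is the nominal introduced by the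
expansion and `D` the set of nominals occurring in the branch before it, both kept up to date when
nominals are replaced. -/
structure Node (P : Type u₁) (N : Type u₂) (V : Type u₃) (S : Type u₄) where
  label : Label P N V S
  parent : Option ℕ
  expanded : Option (N × Set N)

/-- Replacement of nominals in a node. -/
def Node.rename {P : Type u₁} {N : Type u₂} {V : Type u₃} {S : Type u₄} (f : N → N)
    (x : Node P N V S) : Node P N V S :=
  ⟨x.label.rename f, x.parent, x.expanded.map fun e => (f e.1, f '' e.2)⟩

/-- A tableau branch: a finite sequence of nodes. -/
abbrev Branch (P : Type u₁) (N : Type u₂) (V : Type u₃) (S : Type u₄) := List (Node P N V S)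

namespace Branch

variable {P : Type u₁} {N : Type u₂} {V : Type u₃} {S : Type u₄}

/-- `(n) l`: the branch contains the node `n`, with label `l`. -/
def HasNode (B : Branch P N V S) (n : ℕ) (l : Label P N V S) : Prop :=
  ∃ x, B[n]? = some x ∧ x.label = l

/-- `l ∈ B`: some node of the branch is labelled by `l`. -/
def HasLabel (B : Branch P N V S) (l : Label P N V S) : Prop := ∃ n, B.HasNode n l

/-- Nominals occurring in the branch. -/
def noms (B : Branch P N V S) : Set N := {a | ∃ l, B.HasLabel l ∧ a ∈ l.noms}

/-- Top nominals: the nominals occurring in the (current) label of the first node. -/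
def topNoms (B : Branch P N V S) : Set N := {a | ∃ l, B.HasNode 0 l ∧ a ∈ l.noms}

/-- The branch is open: it has no label `a : ¬a`, nor a pair of labels `a : p`, `a : ¬p`. -/
def IsOpen (B : Branch P N V S) : Prop :=
  (∀ a, ¬ B.HasLabel (.sat a (.neg (.term (.nom a))))) ∧
  (∀ a p, ¬ (B.HasLabel (.sat a (.prop p)) ∧ B.HasLabel (.sat a (.neg (.prop p)))))

/-- Two nominals are compatible when they label the same propositional letters and the same
formulae of the form `□_R G`. -/
def Compatible (B : Branch P N V S) (a b : N) : Prop :=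
  (∀ p, B.HasLabel (.sat a (.prop p)) ↔ B.HasLabel (.sat b (.prop p))) ∧
  (∀ R G, B.HasLabel (.sat a (.box R G)) ↔ B.HasLabel (.sat b (.box R G)))

/-- Mappings: injective functions from the nominals of the branch to themselves, which are the
identity on top nominals and map each nominal to a compatible one. -/
structure IsMapping (B : Branch P N V S) (π : N → N) : Prop where
  mapsTo : Set.MapsTo π B.noms B.noms
  injOn : Set.InjOn π B.noms
  top : ∀ a ∈ B.topNoms, π a = a
  compatible : ∀ a ∈ B.noms, B.Compatible a (π a)

/-- `n` and `m` are blockable nodes, and `π` is a mapping of the label of `m` to that of `n`. -/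
def MapsNode (B : Branch P N V S) (π : N → N) (m n : ℕ) : Prop :=
  ∃ l l', B.HasNode m l ∧ B.HasNode n l' ∧ l.Blockable ∧ l'.Blockable ∧
    B.IsMapping π ∧ l.rename π = l'

/-- `p` is the parent of `n` in the offspring relation. -/
def IsParent (B : Branch P N V S) (p n : ℕ) : Prop := ∃ x, B[n]? = some x ∧ x.parent = some p

/-- A node is blocked, either directly or indirectly: its parent is blocked, or its label can be
obtained by a mapping from the label of a previous node which is not blocked. -/
def Blocked (B : Branch P N V S) (n : ℕ) : Prop :=
  (∃ p, ∃ _ : p < n, B.IsParent p n ∧ B.Blocked p) ∨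
  (∃ m, ∃ _ : m < n, ¬ B.Blocked m ∧ ∃ π, B.MapsNode π m n)
termination_by n

/-- A phantom (or indirectly blocked) node: one with a blocked parent. Unfolding `Blocked`, this
means that some proper ancestor in the offspring relation is directly blocked. -/
def Phantom (B : Branch P N V S) (n : ℕ) : Prop := ∃ p, p < n ∧ B.IsParent p n ∧ B.Blocked p

/-- The node `n` is directly blocked by `m` by means of the mapping `π`. -/
def DirectlyBlockedBy (B : Branch P N V S) (n m : ℕ) (π : N → N) : Prop :=
  ¬ B.Phantom n ∧ m < n ∧ ¬ B.Blocked m ∧ B.MapsNode π m n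

/-- `(n) l` is a non-phantom node of the branch. -/
def HasActive (B : Branch P N V S) (n : ℕ) (l : Label P N V S) : Prop :=
  B.HasNode n l ∧ ¬ B.Phantom n

/-- `l` is the label of some non-phantom node of the branch. -/
def HasActiveLabel (B : Branch P N V S) (l : Label P N V S) : Prop := ∃ n, B.HasActive n l

/-! ### Expansion rules -/

/-- The initial tableau for the formula `F` and the assertions `A`: its nodes are all root nodes,
the first one is `a₀ : F`, with `a₀` a new nominal, and the others are labelled by the elements of
`A` and all the assertions derivable from `A` by the assertion rules. -/
def IsInitial (REL : Finset S) (F : Formula P N V S) (A : Set (Assertion S))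
    (B : Branch P N V S) : Prop :=
  ∃ (a₀ : N) (L : List (Assertion S)), a₀ ∉ F.noms ∧
    (∀ α, α ∈ L ↔ Assertion.Closure REL A α) ∧
    B = ⟨.sat a₀ F, none, none⟩ :: L.map fun α => ⟨.asrt α, none, none⟩

/-- Non-blockable rules which add nodes. `Rule B k c`: some rule is applicable to nodes of `B`,
with the node `k` as (minor) premise, and with alternative conclusions the elements of `c`.
Phantom nodes can be used only as major premises `a : □_R F`. -/
inductive Rule (B : Branch P N V S) : ℕ → List (List (Label P N V S)) → Prop
  | and {n : ℕ} {a : N} {F G : Formula P N V S} :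
      B.HasActive n (.sat a (.and F G)) → Rule B n [[.sat a F, .sat a G]]
  | or {n : ℕ} {a : N} {F G : Formula P N V S} :
      B.HasActive n (.sat a (.or F G)) → Rule B n [[.sat a F], [.sat a G]]
  | at {n : ℕ} {a b : N} {F : Formula P N V S} :
      B.HasActive n (.sat a (.at (.nom b) F)) → Rule B n [[.sat b F]]
  | down {n : ℕ} {a : N} {x : V} {F : Formula P N V S} :
      B.HasActive n (.sat a (.down x F)) → Rule B n [[.sat a (F.inst a x)]]
  | box {m : ℕ} {a b : N} {R : Relation S} {F : Formula P N V S} :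
      B.HasLabel (.sat a (.box R F)) → B.HasActive m (.rel a R b) → Rule B m [[.sat b F]]
  | all {n m : ℕ} {a c : N} {F : Formula P N V S} {l : Label P N V S} :
      B.HasActive n (.sat a (.all F)) → B.HasActive m l → c ∈ l.noms → Rule B m [[.sat c F]]
  | link {m : ℕ} {a b : N} {R T : Relation S} :
      B.HasActive m (.rel a R b) → B.HasLabel (.asrt (.sub R T)) → Rule B m [[.rel a T b]]
  | trans {m : ℕ} {a b : N} {R T : Relation S} {F : Formula P N V S} :
      B.HasLabel (.sat a (.box T F)) → B.HasActive m (.rel a R b) →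
        B.HasLabel (.asrt (.transR R)) → B.HasLabel (.asrt (.sub R T)) →
          Rule B m [[.sat b (.box R F)]]

open Classical in
/-- The labels of `c` which do not label any non-phantom node of the branch. -/
noncomputable def missing (B : Branch P N V S) (c : List (Label P N V S)) :
    List (Label P N V S) :=
  (c.filter fun l => ¬ B.HasActiveLabel l).dedup

open Classical in
/-- One expansion step: `B'` is (one of) the branch(es) obtained from `B` by application of an
expansion rule.
* Non-blockable rules: the new nodes are siblings of the (minor) premise w.r.t. the offspring
  relation, and no formula labelling a non-phantom node is added again.
* Blockable rules: they are applied at most once to each node, and only to nodes which are neither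
  directly blocked nor phantoms; the new nodes are children of the expanded one.
* Equality: given a non-phantom node `a : b` with `a ≠ b`, the nominal `a` is replaced by `b` in the
  whole branch. -/
inductive Step : Branch P N V S → Branch P N V S → Prop
  | rule {B : Branch P N V S} {k : ℕ} {x : Node P N V S} {cs : List (List (Label P N V S))}
      {c : List (Label P N V S)} :
      B.Rule k cs → B[k]? = some x → (∀ d ∈ cs, B.missing d ≠ []) → c ∈ cs →
        Step B (B ++ (B.missing c).map fun l => ⟨l, x.parent, none⟩)
  | blockable {B : Branch P N V S} {n : ℕ} {x : Node P N V S} {b : N}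
      {c : List (Label P N V S)} :
      B[n]? = some x → x.expanded = none → ¬ B.Blocked n → b ∉ B.noms →
        x.label.BlockableRule b c →
        Step B (B.set n { x with expanded := some (b, B.noms) } ++
          c.map fun l => ⟨l, some n, none⟩)
  | eq {B : Branch P N V S} {n : ℕ} {a b : N} :
      B.HasActive n (.sat a (.term (.nom b))) → a ≠ b →
        Step B (B.map (Node.rename fun d => if d = a then b else d))

/-- `B` is a branch of some tableau for the formula `F` and the set of assertions `A`. -/
def IsTableauBranch (REL : Finset S) (F : Formula P N V S) (A : Set (Assertion S))
    (B : Branch P N V S) : Prop :=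
  ∃ B₀, IsInitial REL F A B₀ ∧ Relation.ReflTransGen Step B₀ B

/-- The branch is complete: no expansion rule can be applied to it. -/
def Complete (B : Branch P N V S) : Prop := ∀ B', ¬ Step B B'

end Branch

/-! ### The sequence of extensions -/

/-- Names of the nodes in the extensions: `(0, k)` is the node `k` of the branch, and `(i + 1, k)`
is the node obtained from it by the renaming which leads from stage `i` to stage `i + 1`. -/
abbrev ExtName := ℕ × ℕ

/-- Sets of (named and labelled) nodes. -/
abbrev NodeSet (P : Type u₁) (N : Type u₂) (V : Type u₃) (S : Type u₄) :=
  Set (ExtName × Label P N V S)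

/-- Blocking relations: sets of triples `(n, m, π)`. -/
abbrev BlockingRel (N : Type u₂) := Set (ExtName × ExtName × (N → N))

namespace NodeSet

variable {P : Type u₁} {N : Type u₂} {V : Type u₃} {S : Type u₄}

/-- `l ∈ 𝒩`: some node of `𝒩` is labelled by `l`. -/
def HasLabel (𝒩 : NodeSet P N V S) (l : Label P N V S) : Prop := ∃ n, (n, l) ∈ 𝒩

/-- Nominals occurring in `𝒩`. -/
def noms (𝒩 : NodeSet P N V S) : Set N := {a | ∃ l, 𝒩.HasLabel l ∧ a ∈ l.noms}

/-- A blockable node labelled by `l` has a witness in `𝒩`: for some nominal `d`, the labels that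
the blockable rule would produce with `d` occur in `𝒩`. -/
def HasWitness (𝒩 : NodeSet P N V S) (l : Label P N V S) : Prop :=
  ∃ d c, l.BlockableRule d c ∧ ∀ l' ∈ c, 𝒩.HasLabel l'

end NodeSet

namespace Branch

variable {P : Type u₁} {N : Type u₂} {V : Type u₃} {S : Type u₄}

/-- The initial set: the non-phantom nodes, and the nodes labelled by some `a : p` or `a : □_R G`
where `a` occurs in a non-phantom node. -/
def initialSet (B : Branch P N V S) : NodeSet P N V S :=
  {z | z.1.1 = 0 ∧ B.HasNode z.1.2 z.2 ∧
    (¬ B.Phantom z.1.2 ∨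
      ∃ a, (∃ l, B.HasActiveLabel l ∧ a ∈ l.noms) ∧
        ((∃ p, z.2 = .sat a (.prop p)) ∨ ∃ R G, z.2 = .sat a (.box R G)))}

/-- The initial blocking relation: the triples `(n, m, π)` where `n` is a node of the initial set,
without witnesses there, which is directly blocked by `m` by means of `π`. -/
def initialBlocking (B : Branch P N V S) : BlockingRel N :=
  {t | ∃ n m π l, t = ((0, n), (0, m), π) ∧ ((0, n), l) ∈ B.initialSet ∧
    ¬ B.initialSet.HasWitness l ∧ B.DirectlyBlockedBy n m π}

/-- The next set: to a set `𝒩` at stage `i`, add for every node `k` of the initial set a node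
labelled by `θ (label k)`, unless there is already a node with this label. -/
def extendSet (B : Branch P N V S) (i : ℕ) (𝒩 : NodeSet P N V S) (θ : N → N) :
    NodeSet P N V S :=
  𝒩 ∪ {z | ∃ k l, ((0, k), l) ∈ B.initialSet ∧ ¬ 𝒩.HasLabel (l.rename θ) ∧
    z = ((i + 1, k), l.rename θ)}

/-- The next blocking relation, for the extended set `𝒩'`: keep the triples for the nodes which are
still without witnesses; moreover, a new node which is obtained from a node `k` blocked by `m` by
means of `π`, and which has no witness, is blocked by `m` by means of `θ ∘ π`. -/
def extendBlocking (B : Branch P N V S) (i : ℕ) (ℬ : BlockingRel N) (𝒩' : NodeSet P N V S)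
    (θ : N → N) : BlockingRel N :=
  {t | t ∈ ℬ ∧ ∃ l, (t.1, l) ∈ 𝒩' ∧ ¬ 𝒩'.HasWitness l} ∪
  {t | ∃ k m π l, ((0, k), m, π) ∈ B.initialBlocking ∧ ((i + 1, k), l) ∈ 𝒩' ∧
    ¬ 𝒩'.HasWitness l ∧ t = ((i + 1, k), m, θ ∘ π)}

open Classical in
/-- `B.Stage i 𝒩 ℬ`: `𝒩` and `ℬ` are the `i`-th set and the `i`-th blocking relation in some
sequence of extensions for the branch `B`. At each stage a triple `(n, m, π)` is chosen. Let `b` be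
the nominal introduced by the expansion of `m`. Then `θ` is the extension of `π` with `b ↦ bᵢ` for a
new nominal `bᵢ`; in case `b` has been identified with a nominal which already occurred in the branch
when `m` was expanded, `θ` is `π` itself. -/
inductive Stage (B : Branch P N V S) : ℕ → NodeSet P N V S → BlockingRel N → Prop
  | zero : Stage B 0 B.initialSet B.initialBlocking
  | fresh {i : ℕ} {𝒩 : NodeSet P N V S} {ℬ : BlockingRel N} {n : ExtName} {m : ℕ} {π : N → N}
      {x : Node P N V S} {b bi : N} {D : Set N} :
      Stage B i 𝒩 ℬ → (n, (0, m), π) ∈ ℬ → B[m]? = some x → x.expanded = some (b, D) →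
      b ∉ D → bi ∉ B.noms → bi ∉ 𝒩.noms →
      Stage B (i + 1) (B.extendSet i 𝒩 (Function.update π b bi))
        (B.extendBlocking i ℬ (B.extendSet i 𝒩 (Function.update π b bi))
          (Function.update π b bi))
  | replaced {i : ℕ} {𝒩 : NodeSet P N V S} {ℬ : BlockingRel N} {n : ExtName} {m : ℕ} {π : N → N}
      {x : Node P N V S} {b : N} {D : Set N} :
      Stage B i 𝒩 ℬ → (n, (0, m), π) ∈ ℬ → B[m]? = some x → x.expanded = some (b, D) →
      b ∈ D →
      Stage B (i + 1) (B.extendSet i 𝒩 π) (B.extendBlocking i ℬ (B.extendSet i 𝒩 π) π)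

end Branch

/-- The set of nodes `𝒩` is pseudo-saturated with respect to the blocking relation `ℬ`. -/
structure PseudoSaturated {P : Type u₁} {N : Type u₂} {V : Type u₃} {S : Type u₄}
    (REL : Finset S) (𝒩 : NodeSet P N V S) (ℬ : BlockingRel N) : Prop where
  neg_nom : ∀ a, ¬ 𝒩.HasLabel (.sat a (.neg (.term (.nom a))))
  neg_prop : ∀ a p, ¬ (𝒩.HasLabel (.sat a (.prop p)) ∧ 𝒩.HasLabel (.sat a (.neg (.prop p))))
  eq : ∀ a d, 𝒩.HasLabel (.sat a (.term (.nom d))) → a = d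
  and : ∀ a F G, 𝒩.HasLabel (.sat a (.and F G)) →
    𝒩.HasLabel (.sat a F) ∧ 𝒩.HasLabel (.sat a G)
  or : ∀ a F G, 𝒩.HasLabel (.sat a (.or F G)) →
    𝒩.HasLabel (.sat a F) ∨ 𝒩.HasLabel (.sat a G)
  sat : ∀ a d F, 𝒩.HasLabel (.sat a (.at (.nom d) F)) → 𝒩.HasLabel (.sat d F)
  down : ∀ a x F, 𝒩.HasLabel (.sat a (.down x F)) → 𝒩.HasLabel (.sat a (F.inst a x))
  dia : ∀ n a R F, (n, .sat a (.dia R F)) ∈ 𝒩 →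
    ¬ (Label.sat a (.dia R F) : Label P N V S).IsRelational →
    (∀ m π, (n, m, π) ∉ ℬ) → ∃ d, 𝒩.HasLabel (.rel a R d) ∧ 𝒩.HasLabel (.sat d F)
  box : ∀ a R F d, 𝒩.HasLabel (.sat a (.box R F)) → 𝒩.HasLabel (.rel a R d) →
    𝒩.HasLabel (.sat d F)
  ex : ∀ n a F, (n, .sat a (.ex F)) ∈ 𝒩 → (∀ m π, (n, m, π) ∉ ℬ) →
    ∃ d, 𝒩.HasLabel (.sat d F)
  all : ∀ a F, ∀ d ∈ 𝒩.noms, 𝒩.HasLabel (.sat a (.all F)) → 𝒩.HasLabel (.sat d F)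
  incl_refl : ∀ r ∈ REL, 𝒩.HasLabel (.asrt (.sub (.fwd r) (.fwd r)))
  incl_trans : ∀ R T U, 𝒩.HasLabel (.asrt (.sub R T)) → 𝒩.HasLabel (.asrt (.sub T U)) →
    𝒩.HasLabel (.asrt (.sub R U))
  link : ∀ a b R T, 𝒩.HasLabel (.rel a R b) → 𝒩.HasLabel (.asrt (.sub R T)) →
    𝒩.HasLabel (.rel a T b)
  trans : ∀ a b R T F, 𝒩.HasLabel (.sat a (.box T F)) → 𝒩.HasLabel (.rel a R b) →
    𝒩.HasLabel (.asrt (.transR R)) → 𝒩.HasLabel (.asrt (.sub R T)) →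
    𝒩.HasLabel (.sat b (.box R F))

end HybridTableau

/-! Every label of a stage is the image of a label of the initial set under one of a family `Θ` of
maps: the identity and the maps `θ` used so far. The saturation clauses are proved by pulling a
premise back along such a map, using completeness of the branch, and pushing the conclusion forward.
One-premise clauses need only that renaming preserves the shape of formulae; the absence of `a : ¬a`
also needs injectivity of the maps on the nominals of the branch.

The difficulty lies in clauses with two premises, which may come from different maps of `Θ`. Two
facts resolve it. First, no universal operator occurs under a binder, so the binder rule never
places a nominal below `□` or `A`; hence nominals in the scope of universal operators are always top
nominals (`Invariant`), which all maps fix. Second, each nominal `c` has a single local type `τ c`,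
the set of all `p` and `□_R G` that hold at `c`, and every `θ` in `Θ` satisfies `τ (θ a) = localType
a` (`IsTypedMap`). So if `θ a : □_R G` occurs, by whatever map, then `a : □_R G` occurs in the
branch, the rule fires there on the preimage of the relational premise, and its conclusion goes
forward along `θ` with `G` unchanged. Since `□` premises may be taken from phantom nodes, it does
not matter where `a : □_R G` was found.

`IsExtension.extend` shows that an extension step keeps this description; a fresh `bᵢ` simply
receives the local type of `b`. The clauses for `◇` and `E` hold because a blockable node of the
initial set is either expanded, or has a witness, or is recorded as blocked, and because witnesses
are carried along by renaming. `IsExtension.pseudoSaturated` derives the clauses. -/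

namespace HybridTableau

universe u₁ u₂ u₃ u₄

variable {P : Type u₁} {N : Type u₂} {V : Type u₃} {S : Type u₄}

/-! ### Renaming of nominals in terms and formulae -/

namespace Term

theorem noms_rename (f : N → N) (t : Term N V) : (t.rename f).noms = f '' t.noms := by
  cases t <;> simp [rename, noms]

theorem rename_eq_self {f : N → N} {t : Term N V} (h : ∀ a ∈ t.noms, f a = a) :
    t.rename f = t := by
  cases t <;> simp_all [rename, noms]

theorem rename_inst (f : N → N) (a : N) (x : V) (t : Term N V) :
    (t.inst a x).rename f = (t.rename f).inst (f a) x := by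
  cases t with
  | nom b => rfl
  | var y => by_cases h : y = x <;> simp [inst, rename, h]

theorem finite_noms (t : Term N V) : t.noms.Finite := by
  cases t <;> simp [noms]

end Term

namespace Formula

theorem noms_rename (f : N → N) (F : Formula P N V S) : (F.rename f).noms = f '' F.noms := by
  induction F <;> simp_all [rename, noms, Term.noms_rename, Set.image_union]

theorem rename_eq_self {f : N → N} {F : Formula P N V S} (h : ∀ a ∈ F.noms, f a = a) :
    F.rename f = F := by
  induction F with
  | prop p => rfl
  | term t => simp only [rename]; rw [Term.rename_eq_self h]
  | neg F ih | dia R F ih | box R F ih | ex F ih | all F ih | down x F ih =>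
    simp only [rename]; rw [ih h]
  | and F G ihF ihG | or F G ihF ihG =>
    simp only [rename]
    rw [ihF fun a ha => h a (.inl ha), ihG fun a ha => h a (.inr ha)]
  | _ t F ih =>
    simp only [rename]
    rw [Term.rename_eq_self fun a ha => h a (.inl ha), ih fun a ha => h a (.inr ha)]

theorem rename_inst (f : N → N) (a : N) (x : V) (F : Formula P N V S) :
    (F.inst a x).rename f = (F.rename f).inst (f a) x := by
  induction F with
  | down y F ih => by_cases h : y = x <;> simp [inst, rename, h, ih]
  | _ => simp_all [inst, rename, Term.rename_inst]

theorem exists_at_of_rename_eq_at {f : N → N} {F G : Formula P N V S} {b : N}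
    (h : .at (.nom b) G = F.rename f) :
    ∃ b' G', F = .at (.nom b') G' ∧ b = f b' ∧ G = G'.rename f := by
  cases F <;> simp only [rename, reduceCtorEq, Formula.at.injEq] at h
  rename_i t F
  cases t <;> simp only [Term.rename, reduceCtorEq, Term.nom.injEq, false_and] at h
  exact ⟨_, _, rfl, h.1, h.2⟩

theorem finite_noms (F : Formula P N V S) : F.noms.Finite := by
  induction F <;> simp_all [noms, Term.finite_noms]

theorem NoUniversal.inst {F : Formula P N V S} (h : F.NoUniversal) (a : N) (x : V) :
    (F.inst a x).NoUniversal := by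
  induction F with
  | down y F ih => by_cases hy : y = x <;> simp_all [Formula.inst, NoUniversal]
  | _ => simp_all [Formula.inst, NoUniversal]

theorem NoUniversal.rename {F : Formula P N V S} (h : F.NoUniversal) (f : N → N) :
    (F.rename f).NoUniversal := by
  induction F <;> simp_all [Formula.rename, NoUniversal]

/-- No universal operator occurs in the scope of a binder, and the nominals in the scope of
universal operators belong to `T`. -/
def UniversalNomsIn (T : Set N) : Formula P N V S → Prop
  | prop _ => True
  | term _ => True
  | neg F => F.UniversalNomsIn T
  | and F G => F.UniversalNomsIn T ∧ G.UniversalNomsIn T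
  | or F G => F.UniversalNomsIn T ∧ G.UniversalNomsIn T
  | dia _ F => F.UniversalNomsIn T
  | box _ F => F.noms ⊆ T ∧ F.UniversalNomsIn T
  | ex F => F.UniversalNomsIn T
  | all F => F.noms ⊆ T ∧ F.UniversalNomsIn T
  | .at _ F => F.UniversalNomsIn T
  | down _ F => F.NoUniversal

theorem NoUniversal.universalNomsIn {F : Formula P N V S} (h : F.NoUniversal) (T : Set N) :
    F.UniversalNomsIn T := by
  induction F <;> simp_all [UniversalNomsIn, NoUniversal]

/-- This starts the invariant: in the initial branch `T` contains all nominals of the input formula.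
-/
theorem NoUniversalUnderBinder.universalNomsIn {F : Formula P N V S} {T : Set N}
    (h : F.NoUniversalUnderBinder) (hT : F.noms ⊆ T) : F.UniversalNomsIn T := by
  induction F <;> simp_all [UniversalNomsIn, NoUniversalUnderBinder, noms]

/-- The set moves along with the formula because the equality rule may replace top nominals too. -/
theorem UniversalNomsIn.rename {F : Formula P N V S} {T : Set N} (h : F.UniversalNomsIn T)
    (f : N → N) : (F.rename f).UniversalNomsIn (f '' T) := by
  induction F with
  | box R F ih | all F ih =>
    exact ⟨by rw [noms_rename]; exact Set.image_mono h.1, ih h.2⟩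
  | down x F ih => exact NoUniversal.rename h f
  | _ => simp_all [Formula.rename, UniversalNomsIn]

/-- Propositional letters and formulae `□_R G`, i.e. the formulae which are relevant to
compatibility. -/
inductive IsLocal : Formula P N V S → Prop
  | prop (p : P) : IsLocal (prop p)
  | box (R : Relation S) (G : Formula P N V S) : IsLocal (box R G)

theorem isLocal_rename {f : N → N} {F : Formula P N V S} : (F.rename f).IsLocal ↔ F.IsLocal := by
  constructor
  · intro h
    cases F <;> first | exact .prop _ | exact .box _ _ | (simp only [rename] at h; nomatch h)
  · rintro (_ | _)
    exacts [.prop _, .box _ _]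

/-- A letter has no nominals, and those below `□` lie in `T`. This is what allows local formulae to
be compared across different renamings. -/
theorem IsLocal.rename_eq_self {F : Formula P N V S} {T : Set N} {f : N → N} (hF : F.IsLocal)
    (h : F.UniversalNomsIn T) (hf : ∀ a ∈ T, f a = a) : F.rename f = F := by
  cases hF with
  | prop p => rfl
  | box R G => exact Formula.rename_eq_self fun a ha => hf a (h.1 ha)

end Formula

/-! ### Renaming of labels, and the blockable rules -/

namespace Label

theorem noms_rename (f : N → N) (l : Label P N V S) : (l.rename f).noms = f '' l.noms := by
  cases l <;> simp [rename, noms, Formula.noms_rename, Set.image_insert_eq]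

theorem rename_id (l : Label P N V S) : l.rename id = l := by
  cases l with
  | sat a F => exact congrArg (sat a) (Formula.rename_eq_self fun _ _ => rfl)
  | asrt α => rfl

theorem finite_noms (l : Label P N V S) : l.noms.Finite := by
  cases l <;> simp [noms, Formula.finite_noms]

theorem rename_rel (f : N → N) (a : N) (R : Relation S) (b : N) :
    (rel a R b : Label P N V S).rename f = rel (f a) R (f b) := by
  cases R <;> rfl

/-- Renaming changes nominals only, so the shape of the original can be read off its image. Thus
relational formulae pull back to the branch, and blockability is reflected as well as preserved. -/
theorem exists_rel_of_rename_eq_rel {f : N → N} {l : Label P N V S} {a b : N} {R : Relation S}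
    (h : rel a R b = l.rename f) : ∃ a' b', l = rel a' R b' ∧ a = f a' ∧ b = f b' := by
  rcases l with ⟨c, F⟩ | α
  · cases R <;> cases F <;> simp only [rel, rename, Formula.rename, sat.injEq,
      Formula.dia.injEq, reduceCtorEq, and_false] at h
    all_goals
      obtain ⟨rfl, rfl, h⟩ := h
      rename_i G
      cases G <;> simp only [Formula.rename, Formula.term.injEq, reduceCtorEq] at h
      rename_i t
      cases t <;> simp only [Term.rename, Term.nom.injEq, reduceCtorEq] at h
      subst h
      exact ⟨_, _, rfl, rfl, rfl⟩
  · cases R <;> simp [rel, rename] at h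

theorem isRelational_rename {f : N → N} {l : Label P N V S} :
    (l.rename f).IsRelational ↔ l.IsRelational := by
  constructor
  · rintro ⟨a, R, b, h⟩
    obtain ⟨a', b', rfl, -⟩ := exists_rel_of_rename_eq_rel h.symm
    exact ⟨a', R, b', rfl⟩
  · rintro ⟨a, R, b, rfl⟩
    exact ⟨_, _, _, rename_rel f a R b⟩

theorem exists_sat_of_rename_eq_sat {f : N → N} {l : Label P N V S} {a : N}
    {F : Formula P N V S} (h : sat a F = l.rename f) :
    ∃ a' F', l = sat a' F' ∧ a = f a' ∧ F = F'.rename f := by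
  cases l with
  | sat b G =>
    simp only [rename, sat.injEq] at h
    exact ⟨b, G, rfl, h⟩
  | asrt α => simp [rename] at h

theorem BlockableRule.rename {l : Label P N V S} {b : N} {c : List (Label P N V S)}
    (h : l.BlockableRule b c) (f : N → N) :
    (l.rename f).BlockableRule (f b) (c.map (Label.rename f)) := by
  cases h with
  | dia h =>
    simp only [List.map, rename_rel]
    exact .dia fun h' => h (isRelational_rename.1 h')
  | ex => exact .ex

theorem Blockable.exists_blockableRule {l : Label P N V S} (h : l.Blockable) (b : N) :
    ∃ c, l.BlockableRule b c := by
  rcases h with ⟨a, R, F, rfl, h⟩ | ⟨a, F, rfl⟩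
  exacts [⟨_, .dia h⟩, ⟨_, .ex⟩]

theorem blockable_rename {f : N → N} {l : Label P N V S} :
    (l.rename f).Blockable ↔ l.Blockable := by
  constructor
  · rintro (⟨a, R, F, h, hr⟩ | ⟨a, F, h⟩) <;>
    obtain ⟨a', F', rfl, rfl, h'⟩ := exists_sat_of_rename_eq_sat h.symm <;>
    cases F' <;> simp only [Formula.rename, reduceCtorEq, Formula.dia.injEq] at h'
    · exact .inl ⟨_, _, _, rfl, fun h' => hr (h ▸ isRelational_rename.2 h')⟩
    · exact .inr ⟨_, _, rfl⟩
  · rintro (⟨a, R, F, rfl, hr⟩ | ⟨a, F, rfl⟩)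
    · exact .inl ⟨_, _, _, rfl, fun h => hr (isRelational_rename.1 h)⟩
    · exact .inr ⟨_, _, rfl⟩

theorem BlockableRule.exists_mem_noms {l : Label P N V S} {b : N} {c : List (Label P N V S)}
    (h : l.BlockableRule b c) : ∃ l' ∈ c, b ∈ l'.noms := by
  cases h with
  | @dia a R F b h => exact ⟨sat b F, by simp, by simp [noms]⟩
  | @ex a F b => exact ⟨sat b F, by simp, by simp [noms]⟩

/-- The formula of a satisfaction statement satisfies `Formula.UniversalNomsIn`. -/
def UniversalNomsIn (T : Set N) : Label P N V S → Prop
  | sat _ F => F.UniversalNomsIn T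
  | asrt _ => True

theorem UniversalNomsIn.rename {l : Label P N V S} {T : Set N} (h : l.UniversalNomsIn T)
    (f : N → N) : (l.rename f).UniversalNomsIn (f '' T) := by
  cases l with
  | sat a F => exact Formula.UniversalNomsIn.rename h f
  | asrt α => trivial

theorem universalNomsIn_rel (T : Set N) (a : N) (R : Relation S) (b : N) :
    (rel a R b : Label P N V S).UniversalNomsIn T := by
  cases R <;> trivial

theorem BlockableRule.universalNomsIn {l : Label P N V S} {b : N} {c : List (Label P N V S)}
    {T : Set N} (h : l.BlockableRule b c) (hl : l.UniversalNomsIn T) :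
    ∀ l' ∈ c, l'.UniversalNomsIn T := by
  cases h with
  | dia h =>
    simp only [List.mem_cons, List.not_mem_nil, or_false, forall_eq_or_imp, forall_eq]
    exact ⟨universalNomsIn_rel _ _ _ _, hl⟩
  | ex =>
    simp only [List.mem_cons, List.not_mem_nil, or_false, forall_eq]
    exact hl

theorem BlockableRule.ne_asrt {l : Label P N V S} {b : N} {c : List (Label P N V S)}
    (h : l.BlockableRule b c) (α : Assertion S) : asrt α ∉ c := by
  cases h with
  | @dia a R => cases R <;> simp [rel]
  | ex => simp

end Label

/-! ### An invariant of tableau branches -/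

namespace Branch

variable {B : Branch P N V S}

theorem hasLabel_iff {l : Label P N V S} : B.HasLabel l ↔ ∃ x ∈ B, x.label = l := by
  simp only [HasLabel, HasNode, List.mem_iff_getElem?]
  grind

theorem mem_noms {a : N} : a ∈ B.noms ↔ ∃ x ∈ B, a ∈ x.label.noms := by
  simp only [noms, hasLabel_iff, Set.mem_ofPred_eq]
  grind

theorem finite_noms (B : Branch P N V S) : B.noms.Finite := by
  have : B.noms = ⋃ x ∈ {x | x ∈ B}, x.label.noms := by
    ext a; simp [mem_noms]
  rw [this]
  exact (List.finite_toSet B).biUnion fun x _ => x.label.finite_noms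

theorem HasActive.hasLabel {n : ℕ} {l : Label P N V S} (h : B.HasActive n l) : B.HasLabel l :=
  ⟨n, h.1⟩

theorem HasActiveLabel.hasLabel {l : Label P N V S} (h : B.HasActiveLabel l) : B.HasLabel l :=
  h.elim fun _ h => h.hasLabel

theorem topNoms_subset_noms : B.topNoms ⊆ B.noms := fun _ ⟨l, h, ha⟩ => ⟨l, ⟨0, h⟩, ha⟩

theorem topNoms_append {x : Node P N V S} (h : B[0]? = some x) (C : Branch P N V S) :
    (B ++ C).topNoms = B.topNoms := by
  have : (B ++ C)[0]? = B[0]? := by cases B <;> simp_all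
  simp only [topNoms, HasNode, this]

theorem topNoms_set {n : ℕ} {x y : Node P N V S} (h : B[n]? = some x) (hl : y.label = x.label) :
    topNoms (B.set n y) = B.topNoms := by
  cases n <;> cases B <;> simp_all [topNoms, HasNode]

theorem topNoms_map_rename (f : N → N) :
    topNoms (B.map (Node.rename f)) = f '' B.topNoms := by
  ext a
  simp only [topNoms, HasNode, List.getElem?_map, Option.map_eq_some_iff, Set.mem_ofPred_eq,
    Set.mem_image]
  constructor
  · rintro ⟨_, ⟨_, ⟨y, hy, rfl⟩, rfl⟩, ha⟩
    simp only [Node.rename, Label.noms_rename] at ha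
    obtain ⟨b, hb, rfl⟩ := ha
    exact ⟨b, ⟨_, ⟨y, hy, rfl⟩, hb⟩, rfl⟩
  · rintro ⟨b, ⟨_, ⟨y, hy, rfl⟩, hb⟩, rfl⟩
    refine ⟨_, ⟨_, ⟨y, hy, rfl⟩, rfl⟩, ?_⟩
    simp only [Node.rename, Label.noms_rename]
    exact Set.mem_image_of_mem f hb

/-- Properties of the branches of the tableaux for a formula of the fragment and a set `A` of
assertions. -/
structure Invariant (REL : Finset S) (A : Set (Assertion S)) (B : Branch P N V S) : Prop where
  root : ∃ x, B[0]? = some x ∧ x.parent = none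
  closure : ∀ x ∈ B, ∀ α, x.label = .asrt α → Assertion.Closure REL A α
  asrt : ∀ α, Assertion.Closure REL A α → ∃ x ∈ B, x.label = .asrt α ∧ x.parent = none
  universal : ∀ x ∈ B, x.label.UniversalNomsIn B.topNoms
  expanded : ∀ n x b D, B[n]? = some x → x.expanded = some (b, D) → B.topNoms ⊆ D ∧
    ∃ c, x.label.BlockableRule b c ∧ ∀ l ∈ c, ∃ y ∈ B, y.label = l ∧ y.parent = some n

theorem IsInitial.invariant {REL : Finset S} {F : Formula P N V S} {A : Set (Assertion S)}
    (hF : F.InFragment) (h : IsInitial REL F A B) : B.Invariant REL A := by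
  obtain ⟨a₀, L, -, hL, rfl⟩ := h
  constructor
  · exact ⟨_, rfl, rfl⟩
  · simp only [List.mem_cons, List.mem_map, forall_eq_or_imp, reduceCtorEq, false_imp_iff,
      implies_true, true_and]
    rintro _ ⟨β, hβ, rfl⟩ α hα
    cases hα
    exact (hL _).1 hβ
  · intro α hα
    exact ⟨⟨.asrt α, none, none⟩, .tail _ (List.mem_map.2 ⟨α, (hL α).2 hα, rfl⟩), rfl, rfl⟩
  · simp only [List.mem_cons, List.mem_map, forall_eq_or_imp]
    constructor
    · exact hF.2.2.universalNomsIn fun a ha => ⟨_, ⟨_, rfl, rfl⟩, .inr ha⟩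
    · rintro _ ⟨β, hβ, rfl⟩
      trivial
  · intro n x b D hx hb
    have := List.mem_of_getElem? hx
    simp only [List.mem_cons, List.mem_map] at this
    rcases this with rfl | ⟨α, -, rfl⟩ <;> simp at hb

theorem Invariant.universalNomsIn {REL : Finset S} {A : Set (Assertion S)}
    (h : B.Invariant REL A) {l : Label P N V S} (hl : B.HasLabel l) :
    l.UniversalNomsIn B.topNoms := by
  obtain ⟨x, hx, rfl⟩ := hasLabel_iff.1 hl
  exact h.universal x hx

/-- Apart from relational formulae, conclusions are built from subformulae of the premises, except
for the binder rule. That rule can insert an arbitrary nominal, but into a body without universal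
operators. -/
theorem Invariant.universalNomsIn_of_rule {REL : Finset S} {A : Set (Assertion S)}
    (h : B.Invariant REL A) {k : ℕ} {cs : List (List (Label P N V S))} (hr : B.Rule k cs) :
    ∀ c ∈ cs, ∀ l ∈ c, l.UniversalNomsIn B.topNoms := by
  cases hr with
  | and h₁ | or h₁ =>
    have h₂ := h.universalNomsIn h₁.hasLabel
    simp only [List.mem_cons, List.not_mem_nil, or_false, forall_eq_or_imp, forall_eq]
    exact h₂
  | down h₁ =>
    have h₂ := h.universalNomsIn h₁.hasLabel
    simp only [List.mem_cons, List.not_mem_nil, or_false, forall_eq]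
    exact (Formula.NoUniversal.inst h₂ _ _).universalNomsIn _
  | box h₁ _ | trans h₁ _ _ _ =>
    have h₂ := h.universalNomsIn h₁
    simp only [List.mem_cons, List.not_mem_nil, or_false, forall_eq]
    first | exact h₂.2 | exact h₂
  | all h₁ _ _ =>
    have h₂ := h.universalNomsIn h₁.hasLabel
    simp only [List.mem_cons, List.not_mem_nil, or_false, forall_eq]
    exact h₂.2
  | link _ _ =>
    simp only [List.mem_cons, List.not_mem_nil, or_false, forall_eq]
    exact Label.universalNomsIn_rel _ _ _ _
  | _ h₁ =>
    have h₂ := h.universalNomsIn h₁.hasLabel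
    simp only [List.mem_cons, List.not_mem_nil, or_false, forall_eq]
    exact h₂

theorem Rule.ne_asrt {k : ℕ} {cs : List (List (Label P N V S))} (hr : B.Rule k cs) :
    ∀ c ∈ cs, ∀ α, .asrt α ∉ c := by
  cases hr with
  | @link m a b R T => cases T <;> simp [Label.rel]
  | _ => simp

theorem Invariant.rule {REL : Finset S} {A : Set (Assertion S)} (h : B.Invariant REL A)
    {k : ℕ} {cs : List (List (Label P N V S))} {c : List (Label P N V S)} (hr : B.Rule k cs)
    (hc : c ∈ cs) (p : Option ℕ) :
    Invariant REL A (B ++ (B.missing c).map fun l => (⟨l, p, none⟩ : Node P N V S)) := by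
  have hsub : ∀ l ∈ B.missing c, l ∈ c := by
    intro l hl
    simp only [missing, List.mem_dedup, List.mem_filter] at hl
    exact hl.1
  obtain ⟨r, hr₀, hrp⟩ := h.root
  have htop := topNoms_append hr₀ ((B.missing c).map fun l => (⟨l, p, none⟩ : Node P N V S))
  constructor
  · refine ⟨r, ?_, hrp⟩
    cases B <;> simp_all
  · intro x hx α hα
    rcases List.mem_append.1 hx with hx | hx
    · exact h.closure x hx α hα
    · obtain ⟨l, hl, rfl⟩ := List.mem_map.1 hx
      cases hα
      exact absurd (hsub _ hl) (hr.ne_asrt c hc α)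
  · intro α hα
    obtain ⟨x, hx, hx'⟩ := h.asrt α hα
    exact ⟨x, List.mem_append_left _ hx, hx'⟩
  · intro x hx
    rw [htop]
    rcases List.mem_append.1 hx with hx | hx
    · exact h.universal x hx
    · obtain ⟨l, hl, rfl⟩ := List.mem_map.1 hx
      exact h.universalNomsIn_of_rule hr c hc l (hsub l hl)
  · intro n x b D hx hb
    rw [htop]
    rw [List.getElem?_append] at hx
    split at hx
    · obtain ⟨h₁, d, hd, h₂⟩ := h.expanded n x b D hx hb
      refine ⟨h₁, d, hd, fun l hl => ?_⟩
      obtain ⟨y, hy, hy'⟩ := h₂ l hl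
      exact ⟨y, List.mem_append_left _ hy, hy'⟩
    · obtain ⟨l, -, rfl⟩ := List.mem_map.1 (List.mem_of_getElem? hx)
      simp at hb

/-- Marking a node as expanded is invisible to labels and to the offspring relation. -/
theorem exists_mem_set {n : ℕ} {x x' y : Node P N V S} (hx : B[n]? = some x)
    (hl : x'.label = x.label) (hp : x'.parent = x.parent) (hy : y ∈ B) :
    ∃ z ∈ B.set n x', z.label = y.label ∧ z.parent = y.parent := by
  obtain ⟨k, hk⟩ := List.mem_iff_getElem?.1 hy
  by_cases hkn : n = k
  · subst hkn
    obtain rfl : x = y := by simpa [hx] using hk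
    exact ⟨x', List.mem_iff_getElem?.2
      ⟨n, List.getElem?_set_self (List.getElem?_eq_some_iff.1 hx).1⟩, hl, hp⟩
  · exact ⟨y, List.mem_iff_getElem?.2 ⟨k, by simp [hkn, hk]⟩, rfl, rfl⟩

theorem mem_set_imp {n : ℕ} {x x' y : Node P N V S} (hx : B[n]? = some x)
    (hl : x'.label = x.label) (hy : y ∈ B.set n x') : ∃ z ∈ B, z.label = y.label := by
  rcases List.mem_or_eq_of_mem_set hy with hy | rfl
  exacts [⟨y, hy, rfl⟩, ⟨x, List.mem_of_getElem? hx, hl.symm⟩]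

theorem Invariant.blockable {REL : Finset S} {A : Set (Assertion S)} (h : B.Invariant REL A)
    {n : ℕ} {x : Node P N V S} {b : N} {c : List (Label P N V S)} (hx : B[n]? = some x)
    (hc : x.label.BlockableRule b c) :
    Invariant REL A (B.set n { x with expanded := some (b, B.noms) } ++
      c.map fun l => (⟨l, some n, none⟩ : Node P N V S)) := by
  obtain ⟨r, hr₀, hrp⟩ := h.root
  set x' : Node P N V S := { x with expanded := some (b, B.noms) } with hx'
  have hroot : ∃ r, (B.set n x')[0]? = some r ∧ r.parent = none := by
    cases n <;> cases B <;> simp_all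
  obtain ⟨r', hr₁, hrp'⟩ := hroot
  have htop := (topNoms_append hr₁ (c.map fun l => (⟨l, some n, none⟩ : Node P N V S))).trans
    (topNoms_set hx (y := x') rfl)
  constructor
  · refine ⟨r', ?_, hrp'⟩
    generalize B.set n x' = B' at hr₁
    cases B' <;> simp_all
  · intro y hy α hα
    rcases List.mem_append.1 hy with hy | hy
    · obtain ⟨z, hz, hzy⟩ := mem_set_imp hx (x' := x') rfl hy
      exact h.closure z hz α (hzy.trans hα)
    · obtain ⟨l, hl, rfl⟩ := List.mem_map.1 hy
      cases hα
      exact absurd hl (hc.ne_asrt α)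
  · intro α hα
    obtain ⟨y, hy, hy₁, hy₂⟩ := h.asrt α hα
    obtain ⟨z, hz, hz₁, hz₂⟩ := exists_mem_set hx (x' := x') rfl rfl hy
    exact ⟨z, List.mem_append_left _ hz, hz₁.trans hy₁, hz₂.trans hy₂⟩
  · intro y hy
    rw [htop]
    rcases List.mem_append.1 hy with hy | hy
    · obtain ⟨z, hz, hzy⟩ := mem_set_imp hx (x' := x') rfl hy
      exact hzy ▸ h.universal z hz
    · obtain ⟨l, hl, rfl⟩ := List.mem_map.1 hy
      exact hc.universalNomsIn (h.universal x (List.mem_of_getElem? hx)) l hl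
  · intro k y d D hy hd
    rw [htop]
    rw [List.getElem?_append] at hy
    split at hy
    · rw [List.getElem?_set] at hy
      split at hy
      · rename_i hnk
        subst hnk
        have hxy : x' = y := by split at hy <;> simp_all
        subst hxy
        simp only [hx', Option.some.injEq, Prod.mk.injEq] at hd
        obtain ⟨rfl, rfl⟩ := hd
        -- The node just expanded: here `D` is the set of all current nominals, so it contains the
        -- top ones.
        exact ⟨topNoms_subset_noms, c, hc, fun l hl =>
          ⟨_, List.mem_append_right _ (List.mem_map.2 ⟨l, hl, rfl⟩), rfl, rfl⟩⟩
      · obtain ⟨h₁, e, he, h₂⟩ := h.expanded k y d D hy hd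
        refine ⟨h₁, e, he, fun l hl => ?_⟩
        obtain ⟨w, hw, hw₁, hw₂⟩ := h₂ l hl
        obtain ⟨z, hz, hz₁, hz₂⟩ := exists_mem_set hx (x' := x') rfl rfl hw
        exact ⟨z, List.mem_append_left _ hz, hz₁.trans hw₁, hz₂.trans hw₂⟩
    · obtain ⟨l, -, rfl⟩ := List.mem_map.1 (List.mem_of_getElem? hy)
      simp at hd

/-- No injectivity is required of `f`, since the equality rule merges two nominals. Positions and
parents do not change, and each of the other data passes to its image. -/
theorem Invariant.rename {REL : Finset S} {A : Set (Assertion S)} (h : B.Invariant REL A)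
    (f : N → N) : Invariant REL A (B.map (Node.rename f)) := by
  constructor
  · obtain ⟨r, hr₀, hrp⟩ := h.root
    exact ⟨r.rename f, by simp [hr₀], hrp⟩
  · intro x hx α hα
    obtain ⟨y, hy, rfl⟩ := List.mem_map.1 hx
    refine h.closure y hy α ?_
    simp only [Node.rename] at hα
    cases hl : y.label <;> simp_all [Label.rename]
  · intro α hα
    obtain ⟨x, hx, hx₁, hx₂⟩ := h.asrt α hα
    exact ⟨x.rename f, List.mem_map.2 ⟨x, hx, rfl⟩, by simp [Node.rename, hx₁, Label.rename], hx₂⟩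
  · intro x hx
    obtain ⟨y, hy, rfl⟩ := List.mem_map.1 hx
    rw [topNoms_map_rename]
    exact (h.universal y hy).rename f
  · intro n x b D hx hb
    rw [List.getElem?_map, Option.map_eq_some_iff] at hx
    obtain ⟨y, hy, rfl⟩ := hx
    simp only [Node.rename, Option.map_eq_some_iff, Prod.mk.injEq] at hb
    obtain ⟨⟨b, D⟩, hb, rfl, rfl⟩ := hb
    obtain ⟨h₁, c, hc, h₂⟩ := h.expanded n y b D hy hb
    rw [topNoms_map_rename]
    refine ⟨Set.image_mono h₁, _, hc.rename f, fun l hl => ?_⟩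
    obtain ⟨l₀, hl₀, rfl⟩ := List.mem_map.1 hl
    obtain ⟨z, hz, rfl, hz₂⟩ := h₂ l₀ hl₀
    exact ⟨z.rename f, List.mem_map.2 ⟨z, hz, rfl⟩, rfl, hz₂⟩

theorem IsTableauBranch.invariant {REL : Finset S} {F : Formula P N V S}
    {A : Set (Assertion S)} (hF : F.InFragment) (h : IsTableauBranch REL F A B) :
    B.Invariant REL A := by
  obtain ⟨B₀, h₀, h⟩ := h
  induction h with
  | refl => exact h₀.invariant hF
  | tail _ hstep ih =>
    cases hstep with
    | rule hr _ _ hc => exact ih.rule hr hc _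
    | blockable hx _ _ _ hc => exact ih.blockable hx hc
    | eq _ _ => exact ih.rename _

/-! ### Complete branches -/

theorem Rule.exists_node {k : ℕ} {cs : List (List (Label P N V S))} (hr : B.Rule k cs) :
    (∃ x, B[k]? = some x) ∧ cs ≠ [] := by
  cases hr with
  | and h | or h | down h | box _ h | all _ h _ | link h _ | trans _ h _ _ =>
    exact ⟨⟨_, h.1.choose_spec.1⟩, by simp⟩
  | _ h => exact ⟨⟨_, h.1.choose_spec.1⟩, by simp⟩

/-- If every alternative lacked some active label, the restriction against repeated formulae would
not prevent a further step. -/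
theorem Complete.rule (h : B.Complete) {k : ℕ} {cs : List (List (Label P N V S))}
    (hr : B.Rule k cs) : ∃ c ∈ cs, ∀ l ∈ c, B.HasActiveLabel l := by
  obtain ⟨⟨x, hx⟩, hcs⟩ := hr.exists_node
  obtain ⟨c, hc⟩ := List.exists_mem_of_ne_nil cs hcs
  by_contra! hne
  refine h _ (.rule hr hx (fun d hd hmiss => ?_) hc)
  obtain ⟨l, hl, hl'⟩ := hne d hd
  have : l ∈ B.missing d := by simp [missing, hl, hl']
  simp [hmiss] at this

theorem Complete.rule_singleton (h : B.Complete) {k : ℕ} {c : List (Label P N V S)}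
    (hr : B.Rule k [c]) : ∀ l ∈ c, B.HasActiveLabel l := by
  simpa using h.rule hr

theorem Complete.eq (h : B.Complete) {a b : N} (hab : B.HasActiveLabel (.sat a (.term (.nom b)))) :
    a = b := by
  by_contra hne
  obtain ⟨n, hn⟩ := hab
  exact h _ (.eq hn hne)

/-- The branch is finite and there are infinitely many nominals, so a fresh one is always available
to expand a pending node. -/
theorem Complete.expanded [Infinite N] (h : B.Complete) {n : ℕ} {x : Node P N V S}
    (hx : B[n]? = some x) (hl : x.label.Blockable) (hb : ¬ B.Blocked n) :
    ∃ b D, x.expanded = some (b, D) := by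
  obtain ⟨b, hbn⟩ := B.finite_noms.exists_notMem
  obtain ⟨c, hc⟩ := hl.exists_blockableRule b
  cases hex : x.expanded with
  | none => exact absurd (.blockable hx hex hb hbn hc) (h _)
  | some e => exact ⟨e.1, e.2, rfl⟩

theorem hasActiveLabel_of_parent {x : Node P N V S} (hx : x ∈ B)
    (hp : ∀ p, x.parent = some p → ¬ B.Blocked p) : B.HasActiveLabel x.label := by
  obtain ⟨n, hn⟩ := List.mem_iff_getElem?.1 hx
  refine ⟨n, ⟨x, hn, rfl⟩, ?_⟩
  rintro ⟨p, -, ⟨y, hy, hyp⟩, hb⟩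
  obtain rfl : x = y := by simpa [hn] using hy
  exact hp p hyp hb

theorem Blocked.directlyBlockedBy {n : ℕ} (h : B.Blocked n) (hn : ¬ B.Phantom n) :
    ∃ m π, B.DirectlyBlockedBy n m π := by
  rw [Blocked] at h
  rcases h with ⟨p, hp, h₁, h₂⟩ | ⟨m, hm, h₁, π, h₂⟩
  · exact absurd ⟨p, hp, h₁, h₂⟩ hn
  · exact ⟨m, π, hn, hm, h₁, h₂⟩

section Invariant

variable {REL : Finset S} {A : Set (Assertion S)}

theorem Invariant.hasLabel_asrt (h : B.Invariant REL A) {α : Assertion S} :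
    B.HasLabel (.asrt α) ↔ Assertion.Closure REL A α := by
  rw [hasLabel_iff]
  constructor
  · rintro ⟨x, hx, hl⟩
    exact h.closure x hx α hl
  · intro hα
    obtain ⟨x, hx, hl, -⟩ := h.asrt α hα
    exact ⟨x, hx, hl⟩

theorem Invariant.hasActiveLabel_asrt (h : B.Invariant REL A) {α : Assertion S}
    (hα : Assertion.Closure REL A α) : B.HasActiveLabel (.asrt α) := by
  obtain ⟨x, hx, hl, hp⟩ := h.asrt α hα
  exact hl ▸ hasActiveLabel_of_parent hx (by simp [hp])

/-- Children of an unblocked node are not phantoms, since this depends only on the parent. -/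
theorem Invariant.expansion (h : B.Invariant REL A) {n : ℕ} {x : Node P N V S} {b : N} {D : Set N}
    (hx : B[n]? = some x) (hb : x.expanded = some (b, D)) (hn : ¬ B.Blocked n) :
    B.topNoms ⊆ D ∧ ∃ c, x.label.BlockableRule b c ∧ ∀ l ∈ c, B.HasActiveLabel l := by
  obtain ⟨h₁, c, hc, h₂⟩ := h.expanded n x b D hx hb
  refine ⟨h₁, c, hc, fun l hl => ?_⟩
  obtain ⟨y, hy, rfl, hp⟩ := h₂ l hl
  exact hasActiveLabel_of_parent hy (by simpa [hp] using hn)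

theorem Invariant.active_of_mem_topNoms (h : B.Invariant REL A) {a : N} (ha : a ∈ B.topNoms) :
    ∃ l, B.HasActiveLabel l ∧ a ∈ l.noms := by
  obtain ⟨r, hr₀, hrp⟩ := h.root
  obtain ⟨_, ⟨x, hx, rfl⟩, ha⟩ := ha
  obtain rfl : r = x := by simpa [hr₀] using hx
  exact ⟨_, hasActiveLabel_of_parent (List.mem_of_getElem? hx) (by simp [hrp]), ha⟩

/-! ### The initial set -/

theorem HasActiveLabel.initialSet {l : Label P N V S} (h : B.HasActiveLabel l) :
    B.initialSet.HasLabel l := by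
  obtain ⟨n, hn⟩ := h
  exact ⟨(0, n), rfl, hn.1, .inl hn.2⟩

theorem hasLabel_initialSet {l : Label P N V S} : B.initialSet.HasLabel l ↔
    B.HasActiveLabel l ∨ B.HasLabel l ∧ ∃ a G, l = .sat a G ∧ G.IsLocal ∧
      ∃ l', B.HasActiveLabel l' ∧ a ∈ l'.noms := by
  constructor
  · rintro ⟨⟨_, n⟩, -, hn, h | ⟨a, hl', ⟨p, h⟩ | ⟨R, G, h⟩⟩⟩
    · exact .inl ⟨n, hn, h⟩
    · exact .inr ⟨⟨n, hn⟩, a, _, h, .prop p, hl'⟩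
    · exact .inr ⟨⟨n, hn⟩, a, _, h, .box R G, hl'⟩
  · rintro (h | ⟨⟨n, hn⟩, a, G, rfl, hG, hl'⟩)
    · exact h.initialSet
    · refine ⟨(0, n), rfl, hn, .inr ⟨a, hl', ?_⟩⟩
      cases hG with
      | prop p => exact .inl ⟨p, rfl⟩
      | box R G => exact .inr ⟨R, G, rfl⟩

theorem hasLabel_of_initialSet {l : Label P N V S} (h : B.initialSet.HasLabel l) :
    B.HasLabel l := by
  obtain ⟨n, -, h, -⟩ := h
  exact ⟨_, h⟩

theorem hasActiveLabel_of_initialSet {l : Label P N V S} (h : B.initialSet.HasLabel l)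
    (hl : ∀ a G, l = .sat a G → ¬ G.IsLocal) : B.HasActiveLabel l := by
  rcases hasLabel_initialSet.1 h with h | ⟨-, a, G, h₁, h₂, -⟩
  exacts [h, absurd h₂ (hl a G h₁)]

theorem hasActiveLabel_rel_of_initialSet {a b : N} {R : Relation S}
    (h : B.initialSet.HasLabel (.rel a R b)) : B.HasActiveLabel (.rel a R b) := by
  refine hasActiveLabel_of_initialSet h ?_
  cases R <;> rintro c G ⟨⟩ ⟨⟩

theorem noms_initialSet_subset : B.initialSet.noms ⊆ B.noms :=
  fun _ ⟨l, hl, ha⟩ => ⟨l, hasLabel_of_initialSet hl, ha⟩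

/-- A phantom label is admitted only when its subject is active, and any further nominal lies below
a `□`, hence is top and occurs in the first node, which is a root and so never a phantom. -/
theorem Invariant.active_of_mem_noms_initialSet (h : B.Invariant REL A) {a : N}
    (ha : a ∈ B.initialSet.noms) : ∃ l, B.HasActiveLabel l ∧ a ∈ l.noms := by
  obtain ⟨l, hl, ha⟩ := ha
  rcases hasLabel_initialSet.1 hl with hl | ⟨hl, b, G, rfl, hG, hb⟩
  · exact ⟨l, hl, ha⟩
  · have hu := h.universalNomsIn hl
    rcases ha with rfl | ha
    · exact hb
    · cases hG with
      | prop p => exact absurd ha id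
      | box R G => exact h.active_of_mem_topNoms (hu.1 ha)

/-- If unblocked, the node has been expanded and its children are witnesses. If directly blocked,
only the presence of a witness can keep it out of the initial blocking relation. -/
theorem hasWitness_of_initialSet [Infinite N] (h : B.Invariant REL A) (hc : B.Complete)
    {n : ExtName} {l : Label P N V S} (hn : (n, l) ∈ B.initialSet) (hl : l.Blockable)
    (hb : ∀ m π, (n, m, π) ∉ B.initialBlocking) : B.initialSet.HasWitness l := by
  obtain ⟨j, n⟩ := n
  obtain ⟨rfl, ⟨x, hx, rfl⟩, hact⟩ := id hn
  dsimp only at hx hact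
  -- Phantoms enter the initial set only with local labels, and these are not blockable.
  have hph : ¬ B.Phantom n := by
    refine hact.resolve_right ?_
    rintro ⟨a, -, ⟨p, h⟩ | ⟨R, G, h⟩⟩ <;> rw [h] at hl <;>
      rcases hl with ⟨_, _, _, h, -⟩ | ⟨_, _, h⟩ <;> cases h
  by_contra hw
  have hblk : ¬ B.Blocked n := by
    intro hblk
    obtain ⟨m, π, hd⟩ := hblk.directlyBlockedBy hph
    exact hb (0, m) π ⟨n, m, π, _, rfl, hn, hw, hd⟩
  obtain ⟨b, D, hex⟩ := hc.expanded hx hl hblk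
  obtain ⟨-, c, hc', hact'⟩ := h.expansion hx hex hblk
  exact hw ⟨b, c, hc', fun l' hl' => (hact' l' hl').initialSet⟩

end Invariant

/-! ### Local types and the maps that respect them -/

/-- The local formulae which are satisfied by `a` according to the labels of the branch. -/
def localType (B : Branch P N V S) (a : N) : Set (Formula P N V S) :=
  {G | G.IsLocal ∧ B.HasLabel (.sat a G)}

theorem Compatible.localType_eq {a b : N} (h : B.Compatible a b) :
    B.localType a = B.localType b := by
  ext G
  refine and_congr_right fun hG => ?_
  cases hG with
  | prop p => exact h.1 p
  | box R G => exact h.2 R G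

/-- Injective functions from the nominals of the branch to `C`, which are the identity on top
nominals, and such that the local formulae of each nominal are those assigned by `τ` to its
image. -/
structure IsTypedMap (B : Branch P N V S) (τ : N → Set (Formula P N V S)) (C : Set N)
    (θ : N → N) : Prop where
  mapsTo : Set.MapsTo θ B.noms C
  injOn : Set.InjOn θ B.noms
  top : ∀ a ∈ B.topNoms, θ a = a
  type : ∀ a ∈ B.noms, τ (θ a) = B.localType a

theorem IsMapping.isTypedMap {π : N → N} (h : B.IsMapping π) :
    B.IsTypedMap B.localType B.noms π :=
  ⟨h.mapsTo, h.injOn, h.top, fun a ha => (h.compatible a ha).localType_eq.symm⟩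

theorem isTypedMap_id : B.IsTypedMap B.localType B.noms id :=
  ⟨Set.mapsTo_id _, Set.injOn_id _, fun _ _ => rfl, fun _ _ => rfl⟩

theorem IsTypedMap.mono {τ τ' : N → Set (Formula P N V S)} {C C' : Set N} {θ : N → N}
    (h : B.IsTypedMap τ C θ) (hC : C ⊆ C') (hτ : ∀ c ∈ C, τ' c = τ c) :
    B.IsTypedMap τ' C' θ :=
  ⟨h.mapsTo.mono_right hC, h.injOn, h.top,
    fun a ha => (hτ _ (h.mapsTo ha)).trans (h.type a ha)⟩

/-- Compatibility says that a mapping preserves local types. This handles the triples with `θ ∘ π`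
added to the blocking relation. -/
theorem IsTypedMap.comp {τ : N → Set (Formula P N V S)} {C : Set N} {θ π : N → N}
    (h : B.IsTypedMap τ C θ) (hπ : B.IsMapping π) : B.IsTypedMap τ C (θ ∘ π) where
  mapsTo := h.mapsTo.comp hπ.mapsTo
  injOn := h.injOn.comp hπ.injOn hπ.mapsTo
  top a ha := by
    rw [Function.comp_apply, hπ.top a ha, h.top a ha]
  type a ha := (h.type _ (hπ.mapsTo ha)).trans (hπ.compatible a ha).localType_eq.symm

open Classical in
-- As `d` lies outside `C`, redirecting `b` to it cannot destroy injectivity, and the type of `d` is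
-- still free to be chosen.
theorem IsTypedMap.update {τ : N → Set (Formula P N V S)} {C C' : Set N} {π : N → N} {b d : N}
    (h : B.IsTypedMap τ C π) (hC : C ⊆ C') (hd : d ∉ C) (hb : b ∉ B.topNoms)
    (hd' : b ∈ B.noms → d ∈ C') :
    B.IsTypedMap (Function.update τ d (B.localType b)) C' (Function.update π b d) where
  mapsTo a ha := by
    by_cases hab : a = b
    · subst hab; simpa using hd' ha
    · simpa [hab] using hC (h.mapsTo ha)
  injOn a ha a' ha' heq := by
    have h₁ : ∀ a ∈ B.noms, π a ≠ d := fun a ha e => hd (e ▸ h.mapsTo ha)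
    by_cases hab : a = b <;> by_cases hab' : a' = b
    · rw [hab, hab']
    · rw [hab, Function.update_self, Function.update_of_ne hab'] at heq
      exact absurd heq.symm (h₁ a' ha')
    · rw [hab', Function.update_self, Function.update_of_ne hab] at heq
      exact absurd heq (h₁ a ha)
    · rw [Function.update_of_ne hab, Function.update_of_ne hab'] at heq
      exact h.injOn ha ha' heq
  top a ha := by
    have hab : a ≠ b := fun e => hb (e ▸ ha)
    rw [Function.update_of_ne hab, h.top a ha]
  type a ha := by
    by_cases hab : a = b
    · subst hab; simp
    · have : π a ≠ d := fun e => hd (e ▸ h.mapsTo ha)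
      rw [Function.update_of_ne hab, Function.update_of_ne this, h.type a ha]

/-! ### Extensions -/

/-- Properties of the extensions of the branch: the labels of `𝒩` are the images of those of the
initial set by some family `Θ` of functions, and the nominals have the local formulae prescribed
by `τ`. -/
structure IsExtension (B : Branch P N V S) (𝒩 : NodeSet P N V S) (ℬ : BlockingRel N)
    (Θ : Set (N → N)) (τ : N → Set (Formula P N V S)) : Prop where
  nonempty : Θ.Nonempty
  hasLabel_iff : ∀ l, 𝒩.HasLabel l ↔
    ∃ θ ∈ Θ, ∃ l₀, B.initialSet.HasLabel l₀ ∧ l = l₀.rename θ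
  isTypedMap : ∀ θ ∈ Θ, B.IsTypedMap τ (B.noms ∪ 𝒩.noms) θ
  blocking : ∀ n m π, (n, m, π) ∈ ℬ →
    (∃ k, m = (0, k) ∧ ¬ B.Blocked k) ∧ B.IsTypedMap τ (B.noms ∪ 𝒩.noms) π
  type : ∀ c ∈ 𝒩.noms, ∀ G, G ∈ τ c ↔ G.IsLocal ∧ 𝒩.HasLabel (.sat c G)
  witness : ∀ n l, (n, l) ∈ 𝒩 → l.Blockable → (∀ m π, (n, m, π) ∉ ℬ) → 𝒩.HasWitness l

section Extension

variable {REL : Finset S} {A : Set (Assertion S)}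

theorem Invariant.isExtension [Infinite N] (h : B.Invariant REL A) (hc : B.Complete) :
    B.IsExtension B.initialSet B.initialBlocking {id} B.localType where
  nonempty := ⟨id, rfl⟩
  hasLabel_iff l := by simp [Label.rename_id]
  isTypedMap := by
    rintro _ rfl
    exact isTypedMap_id.mono Set.subset_union_left fun _ _ => rfl
  blocking := by
    rintro _ _ _ ⟨n, m, π, l, ⟨⟩, -, -, -, -, hm, l', l'', -, -, -, -, hπ, -⟩
    exact ⟨⟨m, rfl, hm⟩, hπ.isTypedMap.mono Set.subset_union_left fun _ _ => rfl⟩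
  type c hcn G := by
    refine and_congr_right fun hG => ⟨fun hl => ?_, hasLabel_of_initialSet⟩
    exact hasLabel_initialSet.2 (.inr ⟨hl, c, G, rfl, hG, h.active_of_mem_noms_initialSet hcn⟩)
  witness _ _ := hasWitness_of_initialSet h hc

/-- A copy is omitted only when its label is already present, so at the level of labels the
extension is a plain union. -/
theorem hasLabel_extendSet {i : ℕ} {𝒩 : NodeSet P N V S} {θ : N → N} {l : Label P N V S} :
    (B.extendSet i 𝒩 θ).HasLabel l ↔
      𝒩.HasLabel l ∨ ∃ l₀, B.initialSet.HasLabel l₀ ∧ l = l₀.rename θ := by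
  constructor
  · rintro ⟨n, hn | ⟨k, l₀, hk, -, ⟨⟩⟩⟩
    exacts [.inl ⟨n, hn⟩, .inr ⟨l₀, ⟨_, hk⟩, rfl⟩]
  · rintro (⟨n, hn⟩ | ⟨l₀, ⟨⟨j, k⟩, hk⟩, rfl⟩)
    · exact ⟨n, .inl hn⟩
    · by_cases hl : 𝒩.HasLabel (l₀.rename θ)
      · exact hl.imp fun n hn => .inl hn
      · obtain rfl : j = 0 := hk.1
        exact ⟨(i + 1, k), .inr ⟨k, l₀, hk, hl, rfl⟩⟩

theorem noms_subset_noms_extendSet {i : ℕ} {𝒩 : NodeSet P N V S} {θ : N → N} :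
    𝒩.noms ⊆ (B.extendSet i 𝒩 θ).noms :=
  fun _ ⟨l, hl, ha⟩ => ⟨l, hasLabel_extendSet.2 (.inl hl), ha⟩

theorem mem_noms_extendSet {i : ℕ} {𝒩 : NodeSet P N V S} {θ : N → N} {c : N} :
    c ∈ (B.extendSet i 𝒩 θ).noms ↔ c ∈ 𝒩.noms ∨ ∃ a ∈ B.initialSet.noms, c = θ a := by
  constructor
  · rintro ⟨l, hl, ha⟩
    rcases hasLabel_extendSet.1 hl with hl | ⟨l₀, hl₀, rfl⟩
    · exact .inl ⟨l, hl, ha⟩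
    · rw [Label.noms_rename] at ha
      obtain ⟨a, ha, rfl⟩ := ha
      exact .inr ⟨a, ⟨l₀, hl₀, ha⟩, rfl⟩
  · rintro (h | ⟨a, ⟨l, hl, ha⟩, rfl⟩)
    · exact noms_subset_noms_extendSet h
    · refine ⟨l.rename θ, hasLabel_extendSet.2 (.inr ⟨l, hl, rfl⟩), ?_⟩
      rw [Label.noms_rename]
      exact Set.mem_image_of_mem θ ha

theorem Invariant.rename_eq_self_of_isLocal (h : B.Invariant REL A) {θ : N → N}
    (hθ : ∀ a ∈ B.topNoms, θ a = a) {a : N} {G : Formula P N V S} (hG : G.IsLocal)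
    (hl : B.HasLabel (.sat a G)) : G.rename θ = G :=
  hG.rename_eq_self (h.universalNomsIn hl) hθ

theorem _root_.HybridTableau.NodeSet.HasWitness.rename {𝒩 𝒩' : NodeSet P N V S} {θ : N → N}
    {l : Label P N V S} (h : 𝒩.HasWitness l)
    (hθ : ∀ l, 𝒩.HasLabel l → 𝒩'.HasLabel (l.rename θ)) : 𝒩'.HasWitness (l.rename θ) := by
  obtain ⟨d, c, hc, h⟩ := h
  refine ⟨θ d, _, hc.rename θ, fun l' hl' => ?_⟩
  obtain ⟨l₀, hl₀, rfl⟩ := List.mem_map.1 hl'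
  exact hθ l₀ (h l₀ hl₀)

/-- The point is that a new copy gives no new local formulae to an old nominal: if `θ a` is old, its
type already equals that of `a`, and `θ` fixes local formulae. -/
theorem IsExtension.extend [Infinite N] (h : B.Invariant REL A) (hc : B.Complete) {i : ℕ}
    {𝒩 : NodeSet P N V S} {ℬ : BlockingRel N} {Θ : Set (N → N)}
    {τ τ' : N → Set (Formula P N V S)} {θ : N → N} (hE : B.IsExtension 𝒩 ℬ Θ τ)
    (hτ : ∀ c ∈ B.noms ∪ 𝒩.noms, τ' c = τ c)
    (hθ : B.IsTypedMap τ' (B.noms ∪ (B.extendSet i 𝒩 θ).noms) θ) :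
    B.IsExtension (B.extendSet i 𝒩 θ) (B.extendBlocking i ℬ (B.extendSet i 𝒩 θ) θ)
      (insert θ Θ) τ' := by
  have hsub : B.noms ∪ 𝒩.noms ⊆ B.noms ∪ (B.extendSet i 𝒩 θ).noms :=
    Set.union_subset_union_right _ noms_subset_noms_extendSet
  constructor
  · exact Set.insert_nonempty _ _
  · intro l
    rw [hasLabel_extendSet, hE.hasLabel_iff l]
    simp only [Set.mem_insert_iff, exists_eq_or_imp]
    exact or_comm
  · rintro θ' (rfl | hθ')
    exacts [hθ, (hE.isTypedMap θ' hθ').mono hsub hτ]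
  · rintro n m π (⟨ht, -⟩ | ⟨k, m, π, l, hk, -, -, ⟨⟩⟩)
    · exact ⟨(hE.blocking n m π ht).1, (hE.blocking n m π ht).2.mono hsub hτ⟩
    · obtain ⟨n, m, π, l, ⟨⟩, -, -, -, -, hm, l', l'', -, -, -, -, hπ, -⟩ := hk
      exact ⟨⟨m, rfl, hm⟩, hθ.comp hπ⟩
  · intro c hcn G
    constructor
    · intro hG
      rcases mem_noms_extendSet.1 hcn with hcn | ⟨a, ha, rfl⟩
      · rw [hτ c (.inr hcn), hE.type c hcn] at hG
        exact ⟨hG.1, hasLabel_extendSet.2 (.inl hG.2)⟩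
      · rw [hθ.type a (noms_initialSet_subset ha)] at hG
        refine ⟨hG.1, hasLabel_extendSet.2 (.inr ⟨.sat a G, ?_, ?_⟩)⟩
        · exact hasLabel_initialSet.2
            (.inr ⟨hG.2, a, G, rfl, hG.1, h.active_of_mem_noms_initialSet ha⟩)
        · rw [Label.rename, h.rename_eq_self_of_isLocal hθ.top hG.1 hG.2]
    · rintro ⟨hG, hl⟩
      rcases hasLabel_extendSet.1 hl with hl | ⟨l₀, hl₀, heq⟩
      · have hcn' : c ∈ 𝒩.noms := ⟨_, hl, .inl rfl⟩
        rw [hτ c (.inr hcn'), hE.type c hcn']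
        exact ⟨hG, hl⟩
      · obtain ⟨a, G, rfl, rfl, rfl⟩ := Label.exists_sat_of_rename_eq_sat heq
        rw [Formula.isLocal_rename] at hG
        have hl₁ := hasLabel_of_initialSet hl₀
        rw [h.rename_eq_self_of_isLocal hθ.top hG hl₁, hθ.type a ⟨_, hl₁, .inl rfl⟩]
        exact ⟨hG, hl₁⟩
  -- An unwitnessed old node would have kept its triples. An unwitnessed copy of `k` would have
  -- inherited those of `k`, so `k` has a witness in the initial set, whose image under `θ` is a
  -- witness.
  · rintro n l (hn | ⟨k, l, hk, hnew, ⟨⟩⟩) hl hb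
    · by_contra hw
      have hb' : ∀ m π, (n, m, π) ∉ ℬ := fun m π ht =>
        hb m π (.inl ⟨ht, l, .inl hn, hw⟩)
      obtain ⟨d, c, hc, hlab⟩ := hE.witness n l hn hl hb'
      exact hw ⟨d, c, hc, fun l' hl' => hasLabel_extendSet.2 (.inl (hlab l' hl'))⟩
    · by_contra hw
      rw [Label.blockable_rename] at hl
      have hb' : ∀ m π, ((0, k), m, π) ∉ B.initialBlocking := fun m π ht =>
        hb m _ (.inr ⟨k, m, π, _, ht, .inr ⟨k, l, hk, hnew, rfl⟩, hw, rfl⟩)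
      exact hw ((hasWitness_of_initialSet h hc hk hl hb').rename
        fun l' hl' => hasLabel_extendSet.2 (.inr ⟨l', hl', rfl⟩))

theorem Stage.isExtension [Infinite N] (h : B.Invariant REL A) (hc : B.Complete) {i : ℕ}
    {𝒩 : NodeSet P N V S} {ℬ : BlockingRel N} (hs : B.Stage i 𝒩 ℬ) :
    ∃ Θ τ, B.IsExtension 𝒩 ℬ Θ τ := by
  induction hs with
  | zero => exact ⟨_, _, h.isExtension hc⟩
  | @fresh i 𝒩 ℬ n m π x b bi D _ ht hx hex hbD hbi hbi' ih =>
    obtain ⟨Θ, τ, hE⟩ := ih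
    obtain ⟨⟨k, hk, hblk⟩, hπ⟩ := hE.blocking _ _ _ ht
    cases hk
    obtain ⟨htop, c, hrule, hact⟩ := h.expansion hx hex hblk
    obtain ⟨l, hl, hbl⟩ := hrule.exists_mem_noms
    classical
    have hbi'' : bi ∉ B.noms ∪ 𝒩.noms := fun h => h.elim hbi hbi'
    -- The nominal `b` is not top, since `D` contains the top nominals. Moreover `b` occurs in an
    -- active child of the unblocked node `m`, so its image `bi` does occur in the extended set.
    have hθ := hπ.update (C' := B.noms ∪ (B.extendSet i 𝒩 (Function.update π b bi)).noms)
      (Set.union_subset_union_right _ noms_subset_noms_extendSet) hbi'' (fun hb => hbD (htop hb))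
      fun _ => .inr (mem_noms_extendSet.2
        (.inr ⟨b, ⟨l, (hact l hl).initialSet, hbl⟩, by simp⟩))
    refine ⟨_, _, hE.extend h hc (fun c hcn => ?_) (by convert hθ)⟩
    exact Function.update_of_ne (fun e => hbi'' (by rwa [← e])) _ _
  | @replaced i 𝒩 ℬ n m π x b D _ ht hx hex hbD ih =>
    obtain ⟨Θ, τ, hE⟩ := ih
    have hπ := (hE.blocking _ _ _ ht).2
    exact ⟨_, _, hE.extend h hc (fun _ _ => rfl) (hπ.mono
      (Set.union_subset_union_right _ noms_subset_noms_extendSet) fun _ _ => rfl)⟩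

/-! ### Transfer of labels between the branch and its extensions -/

theorem IsExtension.hasLabel_rename {𝒩 : NodeSet P N V S} {ℬ : BlockingRel N}
    {Θ : Set (N → N)} {τ : N → Set (Formula P N V S)} (hE : B.IsExtension 𝒩 ℬ Θ τ) {θ : N → N}
    (hθ : θ ∈ Θ) {l : Label P N V S} (hl : B.HasActiveLabel l) : 𝒩.HasLabel (l.rename θ) :=
  (hE.hasLabel_iff _).2 ⟨θ, hθ, l, hl.initialSet, rfl⟩

/-- Nonlocal labels of the initial set come from non-phantom nodes, so their preimages may serve as
premises of any rule. -/
theorem IsExtension.exists_active_sat {𝒩 : NodeSet P N V S} {ℬ : BlockingRel N}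
    {Θ : Set (N → N)} {τ : N → Set (Formula P N V S)} (hE : B.IsExtension 𝒩 ℬ Θ τ) {a : N}
    {F : Formula P N V S} (hF : ¬ F.IsLocal) (hl : 𝒩.HasLabel (.sat a F)) :
    ∃ θ ∈ Θ, ∃ a' F', B.HasActiveLabel (.sat a' F') ∧ a = θ a' ∧ F = F'.rename θ := by
  obtain ⟨θ, hθ, l₀, hl₀, heq⟩ := (hE.hasLabel_iff _).1 hl
  obtain ⟨a', F', rfl, rfl, rfl⟩ := Label.exists_sat_of_rename_eq_sat heq
  rw [Formula.isLocal_rename] at hF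
  exact ⟨θ, hθ, a', F', hasActiveLabel_of_initialSet hl₀ (by rintro _ _ ⟨⟩; exact hF), rfl, rfl⟩

theorem IsExtension.exists_active_rel {𝒩 : NodeSet P N V S} {ℬ : BlockingRel N}
    {Θ : Set (N → N)} {τ : N → Set (Formula P N V S)} (hE : B.IsExtension 𝒩 ℬ Θ τ) {a b : N}
    {R : Relation S} (hl : 𝒩.HasLabel (.rel a R b)) :
    ∃ θ ∈ Θ, ∃ a' b', B.HasActiveLabel (.rel a' R b') ∧ a = θ a' ∧ b = θ b' := by
  obtain ⟨θ, hθ, l₀, hl₀, heq⟩ := (hE.hasLabel_iff _).1 hl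
  obtain ⟨a', b', rfl, rfl, rfl⟩ := Label.exists_rel_of_rename_eq_rel heq
  exact ⟨θ, hθ, a', b', hasActiveLabel_rel_of_initialSet hl₀, rfl, rfl⟩

theorem IsExtension.hasLabel_asrt {𝒩 : NodeSet P N V S} {ℬ : BlockingRel N}
    {Θ : Set (N → N)} {τ : N → Set (Formula P N V S)} (h : B.Invariant REL A)
    (hE : B.IsExtension 𝒩 ℬ Θ τ) {α : Assertion S} :
    𝒩.HasLabel (.asrt α) ↔ Assertion.Closure REL A α := by
  constructor
  · intro hl
    obtain ⟨θ, hθ, l₀, hl₀, heq⟩ := (hE.hasLabel_iff _).1 hl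
    cases l₀ <;> simp only [Label.rename, reduceCtorEq, Label.asrt.injEq] at heq
    subst heq
    exact h.hasLabel_asrt.1 (hasLabel_of_initialSet hl₀)
  · intro hα
    obtain ⟨θ, hθ⟩ := hE.nonempty
    exact hE.hasLabel_rename hθ (h.hasActiveLabel_asrt hα)

/-- A local formula satisfied by the image of a nominal is satisfied by the nominal itself in the
branch. -/
theorem IsExtension.hasLabel_of_isLocal {𝒩 : NodeSet P N V S} {ℬ : BlockingRel N}
    {Θ : Set (N → N)} {τ : N → Set (Formula P N V S)} (hE : B.IsExtension 𝒩 ℬ Θ τ) {θ : N → N}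
    (hθ : θ ∈ Θ) {a : N} (ha : a ∈ B.noms) {G : Formula P N V S} (hG : G.IsLocal)
    (hl : 𝒩.HasLabel (.sat (θ a) G)) : B.HasLabel (.sat a G) := by
  have := (hE.type (θ a) ⟨_, hl, .inl rfl⟩ G).2 ⟨hG, hl⟩
  rw [(hE.isTypedMap θ hθ).type a ha] at this
  exact this.2

theorem mem_noms_of_hasLabel_rel {a b : N} {R : Relation S} (h : B.HasLabel (.rel a R b)) :
    a ∈ B.noms :=
  ⟨_, h, by cases R <;> simp [Label.rel, Label.noms, Formula.noms, Term.noms]⟩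

end Extension

end Branch

/-! ### The saturation conditions -/

open Branch in
theorem Branch.IsExtension.pseudoSaturated {REL : Finset S} {A : Set (Assertion S)}
    {B : Branch P N V S} (h : B.Invariant REL A) (hc : B.Complete) (ho : B.IsOpen)
    {𝒩 : NodeSet P N V S} {ℬ : BlockingRel N} {Θ : Set (N → N)}
    {τ : N → Set (Formula P N V S)} (hE : B.IsExtension 𝒩 ℬ Θ τ) :
    PseudoSaturated REL 𝒩 ℬ := by
  constructor
  · intro a hl
    obtain ⟨θ, hθ, a', F', hact, rfl, heq⟩ := hE.exists_active_sat (by rintro ⟨⟩) hl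
    cases F' with
    | neg F' =>
      cases F' with
      | term t =>
        cases t with
        | nom b =>
          simp only [Formula.rename, Term.rename, Formula.neg.injEq, Formula.term.injEq,
            Term.nom.injEq] at heq
          have : a' = b := (hE.isTypedMap θ hθ).injOn ⟨_, hact.hasLabel, .inl rfl⟩
            ⟨_, hact.hasLabel, .inr rfl⟩ heq
          subst this
          exact ho.1 a' hact.hasLabel
        | var x => simp [Formula.rename, Term.rename] at heq
      | _ => simp [Formula.rename] at heq
    | _ => simp [Formula.rename] at heq
  · rintro a p ⟨hp, hl⟩
    obtain ⟨θ, hθ, a', F', hact, rfl, heq⟩ := hE.exists_active_sat (by rintro ⟨⟩) hl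
    cases F' with
    | neg F' =>
      cases F' with
      | prop q =>
        simp only [Formula.rename, Formula.neg.injEq, Formula.prop.injEq] at heq
        subst heq
        -- The positive literal may come from another map of `Θ`; the common local type brings it
        -- back to the same `a'`.
        exact ho.2 a' p ⟨hE.hasLabel_of_isLocal hθ ⟨_, hact.hasLabel, .inl rfl⟩ (.prop p) hp,
          hact.hasLabel⟩
      | _ => simp [Formula.rename] at heq
    | _ => simp [Formula.rename] at heq
  · intro a d hl
    obtain ⟨θ, hθ, a', F', hact, rfl, heq⟩ := hE.exists_active_sat (by rintro ⟨⟩) hl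
    cases F' with
    | term t =>
      cases t with
      | nom b =>
        simp only [Formula.rename, Term.rename, Formula.term.injEq, Term.nom.injEq] at heq
        rw [heq, hc.eq hact]
      | var x => simp [Formula.rename, Term.rename] at heq
    | _ => simp [Formula.rename] at heq
  · intro a F G hl
    obtain ⟨θ, hθ, a', F', ⟨n, hact⟩, rfl, heq⟩ := hE.exists_active_sat (by rintro ⟨⟩) hl
    cases F' with
    | and F' G' =>
      simp only [Formula.rename, Formula.and.injEq] at heq
      obtain ⟨rfl, rfl⟩ := heq
      have := hc.rule_singleton (.and hact)
      simp only [List.mem_cons, List.not_mem_nil, or_false, forall_eq_or_imp, forall_eq] at this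
      exact ⟨hE.hasLabel_rename hθ this.1, hE.hasLabel_rename hθ this.2⟩
    | _ => simp [Formula.rename] at heq
  · intro a F G hl
    obtain ⟨θ, hθ, a', F', ⟨n, hact⟩, rfl, heq⟩ := hE.exists_active_sat (by rintro ⟨⟩) hl
    cases F' with
    | or F' G' =>
      simp only [Formula.rename, Formula.or.injEq] at heq
      obtain ⟨rfl, rfl⟩ := heq
      have := hc.rule (.or hact)
      simp only [List.mem_cons, List.not_mem_nil, or_false, exists_eq_or_imp, exists_eq_left,
        forall_eq] at this
      exact this.imp (hE.hasLabel_rename hθ) (hE.hasLabel_rename hθ)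
    | _ => simp [Formula.rename] at heq
  · intro a d F hl
    obtain ⟨θ, hθ, a', F', ⟨n, hact⟩, rfl, heq⟩ := hE.exists_active_sat (by rintro ⟨⟩) hl
    obtain ⟨b, G, rfl, rfl, rfl⟩ := Formula.exists_at_of_rename_eq_at heq
    exact hE.hasLabel_rename hθ (hc.rule_singleton (.at hact) _ (.head _))
  · intro a x F hl
    obtain ⟨θ, hθ, a', F', ⟨n, hact⟩, rfl, heq⟩ := hE.exists_active_sat (by rintro ⟨⟩) hl
    cases F' with
    | down y F' =>
      simp only [Formula.rename, Formula.down.injEq] at heq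
      obtain ⟨rfl, rfl⟩ := heq
      rw [← Formula.rename_inst]
      exact hE.hasLabel_rename hθ (hc.rule_singleton (.down hact) _ (.head _))
    | _ => simp [Formula.rename] at heq
  · intro n a R F hn hr hb
    obtain ⟨d, c, hrule, hl⟩ := hE.witness n _ hn (.inl ⟨a, R, F, rfl, hr⟩) hb
    cases hrule
    exact ⟨d, hl _ (by simp), hl _ (by simp)⟩
  · intro a R F d hbox hrel
    obtain ⟨θ, hθ, a', d', ⟨n, hact⟩, rfl, rfl⟩ := hE.exists_active_rel hrel
    -- The map is chosen from the relational premise; the `□` premise is recovered in the branch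
    -- from the local type, possibly at a phantom node.
    have hbox' := hE.hasLabel_of_isLocal hθ (mem_noms_of_hasLabel_rel hact.hasLabel)
      (.box R F) hbox
    have := hE.hasLabel_rename hθ (hc.rule_singleton (.box hbox' hact) _ (.head _))
    rwa [Label.rename, Formula.rename_eq_self fun c hcn =>
      (hE.isTypedMap θ hθ).top c ((h.universalNomsIn hbox').1 hcn)] at this
  · intro n a F hn hb
    obtain ⟨d, c, hrule, hl⟩ := hE.witness n _ hn (.inr ⟨a, F, rfl⟩) hb
    cases hrule
    exact ⟨d, hl _ (by simp)⟩
  · rintro a F d ⟨l, hl, hd⟩ hall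
    obtain ⟨θ, hθ, a', F', ⟨n, hact⟩, rfl, heq⟩ := hE.exists_active_sat (by rintro ⟨⟩) hall
    cases F' with
    | all F' =>
      simp only [Formula.rename, Formula.all.injEq] at heq
      have htop : F'.noms ⊆ B.topNoms := (h.universalNomsIn hact.hasLabel).1
      rw [Formula.rename_eq_self fun c hcn => (hE.isTypedMap θ hθ).top c (htop hcn)] at heq
      subst heq
      -- The nominal may come from a different map `θ'`. Both maps fix `F'`, so the conclusion
      -- obtained in the branch is pushed forward along `θ'`.
      obtain ⟨θ', hθ', l₀, hl₀, rfl⟩ := (hE.hasLabel_iff _).1 hl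
      rw [Label.noms_rename] at hd
      obtain ⟨d, hd, rfl⟩ := hd
      obtain ⟨l, ⟨m, hm⟩, hdl⟩ := h.active_of_mem_noms_initialSet ⟨l₀, hl₀, hd⟩
      have := hE.hasLabel_rename hθ' (hc.rule_singleton (.all hact hm hdl) _ (.head _))
      rwa [Label.rename, Formula.rename_eq_self fun c hcn =>
        (hE.isTypedMap θ' hθ').top c (htop hcn)] at this
    | _ => simp [Formula.rename] at heq
  · intro r hr
    exact (hE.hasLabel_asrt h).2 (.refl hr)
  · intro R T U h₁ h₂
    exact (hE.hasLabel_asrt h).2 (((hE.hasLabel_asrt h).1 h₁).trans ((hE.hasLabel_asrt h).1 h₂))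
  · intro a b R T hrel hsub
    obtain ⟨θ, hθ, a', b', ⟨n, hact⟩, rfl, rfl⟩ := hE.exists_active_rel hrel
    -- Assertions contain no nominals, so every stage has exactly those of the branch.
    rw [hE.hasLabel_asrt h, ← h.hasLabel_asrt] at hsub
    rw [← Label.rename_rel]
    exact hE.hasLabel_rename hθ (hc.rule_singleton (.link hact hsub) _ (.head _))
  · intro a b R T F hbox hrel htrans hsub
    obtain ⟨θ, hθ, a', b', ⟨n, hact⟩, rfl, rfl⟩ := hE.exists_active_rel hrel
    have hbox' := hE.hasLabel_of_isLocal hθ (mem_noms_of_hasLabel_rel hact.hasLabel)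
      (.box T F) hbox
    rw [hE.hasLabel_asrt h, ← h.hasLabel_asrt] at hsub htrans
    have := hE.hasLabel_rename hθ
      (hc.rule_singleton (.trans hbox' hact htrans hsub) _ (.head _))
    rwa [Label.rename, Formula.rename, Formula.rename_eq_self fun c hcn =>
      (hE.isTypedMap θ hθ).top c ((h.universalNomsIn hbox').1 hcn)] at this

end HybridTableau

theorem lemma12 {P N V S : Type*} [Infinite N]
    (REL : Finset S) (F : HybridTableau.Formula P N V S) (A : Set (HybridTableau.Assertion S))
    (hF : F.InFragment) (hFREL : F.syms ⊆ REL) (hAREL : ∀ α ∈ A, α.syms ⊆ REL)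
    (B : HybridTableau.Branch P N V S)
    (hB : HybridTableau.Branch.IsTableauBranch REL F A B)
    (hcomplete : B.Complete) (hopen : B.IsOpen)
    (i : ℕ) (𝒩 : HybridTableau.NodeSet P N V S) (ℬ : HybridTableau.BlockingRel N)
    (hi : B.Stage i 𝒩 ℬ) :
    HybridTableau.PseudoSaturated REL 𝒩 ℬ := by
  have hinv := hB.invariant hF
  obtain ⟨Θ, τ, hE⟩ := hi.isExtension hinv hcomplete
  exact hE.pseudoSaturated hinv hcomplete hopen
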